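/- **Setting.** Let $G$ be a compact abelian Lie group and let $A$ be a finite partially ordered set with a least element $0$. An *iterated space* $X_*$ over $A$ consists of non-empty compact manifolds with corners $X_\alpha$ ($\alpha\in A$), the boundary hypersurfaces of $X_\alpha$ being partitioned into collective boundary hypersurfaces $H_\beta(X_\alpha)$, $\beta>\alpha$, each with mutually disjoint elements, together with fibre bundles $\psi_{\beta,\alpha}:H_\beta(X_\alpha)\to X_\beta$. It is required that $H_\beta(X_\alpha)$ and $H_\gamma(X_\alpha)$ meet if and only if $\beta$ and $\gamma$ are comparable, that $\psi_{\beta,\alpha}(H_\gamma(X_\alpha)\cap H_\beta(X_\alpha))=H_\gamma(X_\beta)$ for $\alpha<\beta<\gamma$, and that there $\psi_{\gamma,\alpha}=\psi_{\gamma,\beta}\circ\psi_{\beta,\alpha}$. Let $G$ act smoothly on $X_*$ (on all $X_\alpha$, preserving the $H_\beta(X_\alpha)$, with equivariant $\psi_{\beta,\alpha}$) with one fixed isotropy group $B_\alpha$ at all points of $X_\alpha$, and let $Y_*$, $Y_\alpha=X_\alpha/G$, be the quotient iterated space, with induced fibrations $\phi_{\beta,\alpha}:H_\beta(Y_\alpha)\to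 Y_\beta$. (For example, $X_*$ is the resolution of a smooth action of $G$ on a compact manifold and $Y_*$ is the resolved quotient.) Each character $\chi\in\widehat{G/B_\alpha}\subset\hat G$ defines a Hermitian line bundle on $Y_\alpha$, whose sections are the functions $s$ on $X_\alpha$ with $s(gx)=\chi(g)s(x)$. Fix an *iterated connection*: Hermitian connections $d-i\theta_{\alpha,\chi}$ on these line bundles, given by $G$-invariant real $1$-forms $\theta_{\alpha,\chi}$ on $X_\alpha$ with $i\,\theta_{\alpha,\chi}(\xi_X)=d\chi(\xi)$ for $\xi\in\mathfrak g$, with $\theta_{\alpha,\chi\chi'}=\theta_{\alpha,\chi}+\theta_{\alpha,\chi'}$, and with $\theta_{\alpha,\chi}|_{H_\beta(X_\alpha)}=\psi_{\beta,\alpha}^*\theta_{\beta,\chi}$ for $\alpha<\beta$ and $\chi\in\widehat{G/B_\beta}\subset\widehat{G/B_\alpha}$. Let $F_{\alpha,\chi}$ be the $2$-form on $Y_\alpha$ which lifts to $d\theta_{\alpha,\chi}$ and put $\mathrm{Ch}(\chi)=\exp(F_{\alpha,\chi}/2\pi)$. *Twisted forms.* $C^\infty(Y_\alpha;\Lambda^*_{\mathrm{dl}})$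 is the complex vector space of finite sums $\sum_i u_i\otimes\hat g_i$, where $u_i$ is a smooth complex form on $Y_\alpha$ and $\hat g_i\in\hat G$, modulo the relations $u\otimes\hat g\simeq(\mathrm{Ch}(\chi)\wedge u)\otimes\chi\hat g$ for $\chi\in\widehat{G/B_\alpha}$, with the differential $d(u\otimes\hat g)=du\otimes\hat g$ and the $\mathbb Z/2$-grading by the parity of the degree of forms. Twisted forms on $H_\beta(Y_\alpha)$ are defined in the same way from $\widehat{G/B_\alpha}$ and the restricted forms $\mathrm{Ch}(\chi)|_{H_\beta(Y_\alpha)}$. Since $B_\alpha\subset B_\beta$ for $\alpha<\beta$, there is an augmented pull-back $\phi_{\beta,\alpha}^{\#}$, $u\otimes\hat g\mapsto\phi_{\beta,\alpha}^*u\otimes\hat g$, from twisted forms on $Y_\beta$ to twisted forms on $H_\beta(Y_\alpha)$. *Delocalized cohomology.* For subsets $S,P\subset A$ consider the $\mathbb Z/2$-graded complex of families $(u_\alpha)_{\alpha\in S}$ of twisted forms $u_\alpha\in C^\infty(Y_\alpha;\Lambda^*_{\mathrm{dl}})$ such that $$u_\alpha|_{H_\beta(Y_\alpha)}=\phi_{\beta,\alpha}^{\#}u_\beta\quad(\alpha<\beta\text{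 in }S),\qquad u_\alpha=0\quad(\alpha\in S\cap P).$$ Let $H^0_{\mathrm{dl}}(Y_*;P)$ and $H^1_{\mathrm{dl}}(Y_*;P)$ be its even and odd cohomology for $S=A$, and $H^0_{\mathrm{dl}}(Y_\alpha;P)$ and $H^1_{\mathrm{dl}}(Y_\alpha;P)$ those for $S=\{\beta\in A:\beta\ge\alpha\}$, that is, for the iterated space with principal space $Y_\alpha$. **Proposition.** Let $P\subset A$ and $\alpha\in A\setminus P$ be such that $A'=A\setminus P$ and $A'\setminus\{\alpha\}$ are subtrees, that is, downward closed in $A$. Then there is a six-term exact sequence of complex vector spaces $$\begin{array}{ccccc}H^0_{\mathrm{dl}}(Y_*;P\cup\{\alpha\})&\longrightarrow&H^0_{\mathrm{dl}}(Y_*;P)&\longrightarrow&H^0_{\mathrm{dl}}(Y_\alpha;P)\\ \uparrow&&&&\downarrow\\ H^1_{\mathrm{dl}}(Y_\alpha;P)&\longleftarrow&H^1_{\mathrm{dl}}(Y_*;P)&\longleftarrow&H^1_{\mathrm{dl}}(Y_*;P\cup\{\alpha\})\end{array}$$ in which the maps $H^\varepsilon_{\mathrm{dl}}(Y_*;P\cup\{\alpha\})\to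 H^\varepsilon_{\mathrm{dl}}(Y_*;P)$ are induced by inclusion of forms, the maps $H^\varepsilon_{\mathrm{dl}}(Y_*;P)\to H^\varepsilon_{\mathrm{dl}}(Y_\alpha;P)$ by restriction of families, and the connecting maps $H^\varepsilon_{\mathrm{dl}}(Y_\alpha;P)\to H^{\varepsilon+1}_{\mathrm{dl}}(Y_*;P\cup\{\alpha\})$ are given by $[u]\mapsto[d\tilde u]$, where $\tilde u$ is an element of the complex of $(Y_*;P)$, of parity $\varepsilon$, which restricts to $u$. -/

import Mathlib

open scoped Manifold ContDiff

namespace Deloc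

universe u v w

/-- A compact Hausdorff smooth manifold with corners, of fixed dimension. -/
structure CornerManifold : Type (u + 1) where
  carrier : Type u
  dim : ℕ
  [top : TopologicalSpace carrier]
  [charted : ChartedSpace (EuclideanQuadrant dim) carrier]
  [smooth : IsManifold (modelWithCornersEuclideanQuadrant dim) ∞ carrier]
  [compact : CompactSpace carrier]
  [t2 : T2Space carrier]

instance : CoeSort CornerManifold.{u} (Type u) := ⟨CornerManifold.carrier⟩

attribute [instance] CornerManifold.top CornerManifold.charted CornerManifold.smooth
  CornerManifold.compact CornerManifold.t2

/-- The model space of the tangent spaces. -/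
abbrev CornerManifold.E (M : CornerManifold.{u}) : Type := EuclideanSpace ℝ (Fin M.dim)

/-- The model with corners of a manifold with corners. -/
noncomputable abbrev CornerManifold.I (M : CornerManifold.{u}) :
    ModelWithCorners ℝ M.E (EuclideanQuadrant M.dim) :=
  modelWithCornersEuclideanQuadrant M.dim

instance (M : CornerManifold.{u}) : IsManifold M.I 1 M :=
  IsManifold.of_le (n := ∞) (by norm_num)

/-- A `V`-valued differential `k`-form, not required to be smooth: an alternating `k`-linear form
on each tangent space (recall that `TangentSpace M.I x` is by definition `M.E`). -/
abbrev RawForm (M : CornerManifold.{u}) (V : Type) [NormedAddCommGroup V] [NormedSpace ℝ V]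
    (k : ℕ) : Type u :=
  (x : M) → (TangentSpace M.I x) [⋀^Fin k]→L[ℝ] V

lemma contDiffWithinAt_clm {X E F : Type*} [NormedAddCommGroup X] [NormedSpace ℝ X]
    [NormedAddCommGroup E] [NormedSpace ℝ E] [FiniteDimensional ℝ E]
    [NormedAddCommGroup F] [NormedSpace ℝ F]
    {n : WithTop ℕ∞} {s : Set X} {x : X} {f : X → E →L[ℝ] F} :
    ContDiffWithinAt ℝ n f s x ↔ ∀ y, ContDiffWithinAt ℝ n (fun x => f x y) s x := by
  refine ⟨fun h y => h.clm_apply contDiffWithinAt_const, fun h => ?_⟩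
  have hd : Module.finrank ℝ E = Module.finrank ℝ (Fin (Module.finrank ℝ E) → ℝ) :=
    (Module.finrank_fin_fun ℝ).symm
  let e₁ := ContinuousLinearEquiv.ofFinrankEq hd
  let e₂ := (e₁.arrowCongr (1 : F ≃L[ℝ] F)).trans
    (ContinuousLinearEquiv.piRing (Fin (Module.finrank ℝ E)))
  rw [← Function.id_comp f, ← e₂.symm_comp_self]
  exact e₂.symm.contDiff.comp_contDiffWithinAt (contDiffWithinAt_pi.mpr fun i => h _)

lemma contDiffWithinAt_altComp {X E F V : Type*} [NormedAddCommGroup X] [NormedSpace ℝ X]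
    [NormedAddCommGroup E] [NormedSpace ℝ E] [FiniteDimensional ℝ E]
    [NormedAddCommGroup F] [NormedSpace ℝ F] [NormedAddCommGroup V] [NormedSpace ℝ V]
    {n : WithTop ℕ∞} {s : Set X} {x : X} {k : ℕ} {a : X → F [⋀^Fin k]→L[ℝ] V} {g : X → E →L[ℝ] F}
    (ha : ContDiffWithinAt ℝ n a s x) (hg : ContDiffWithinAt ℝ n g s x) :
    ContDiffWithinAt ℝ n (fun z => (a z).compContinuousLinearMap (g z)) s x := by
  induction k with
  | zero =>
    have h1 : ContDiff ℝ n (ContinuousAlternatingMap.constOfIsEmptyLIE ℝ E V (Fin 0)) :=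
      ContinuousLinearEquiv.contDiff
        (ContinuousAlternatingMap.constOfIsEmptyLIE ℝ E V (Fin 0)).toContinuousLinearEquiv
    have h2 : ContDiff ℝ n (ContinuousAlternatingMap.constOfIsEmptyLIE ℝ F V (Fin 0)).symm :=
      ContinuousLinearEquiv.contDiff
        (ContinuousAlternatingMap.constOfIsEmptyLIE ℝ F V (Fin 0)).toContinuousLinearEquiv.symm
    refine (h1.comp_contDiffWithinAt (h2.comp_contDiffWithinAt ha)).congr_of_eventuallyEq
      (Filter.Eventually.of_forall fun z => ?_) ?_ <;>
    · ext v
      exact congrArg (a _) (Subsingleton.elim (α := Fin 0 → F) _ _)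
  | succ k ih =>
    have h1 : ContDiff ℝ n (ContinuousAlternatingMap.alternatizeUncurryFinCLM ℝ E V (n := k)) :=
      ContinuousLinearMap.contDiff _
    have h2 : ContDiff ℝ n (ContinuousAlternatingMap.curryLeftLI (𝕜 := ℝ) (E := F) (F := V) (n := k)) :=
      LinearIsometry.contDiff _
    have h3 : ContDiffWithinAt ℝ n
        (fun z => ((a z).compContinuousLinearMap (g z)).curryLeft) s x := by
      rw [contDiffWithinAt_clm]
      intro e
      have := ih (a := fun z => (a z).curryLeft (g z e))
        (((h2.comp_contDiffWithinAt ha)).clm_apply (hg.clm_apply contDiffWithinAt_const))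
      refine this.congr_of_eventuallyEq (Filter.Eventually.of_forall fun z => ?_) ?_ <;>
      exact ContinuousAlternatingMap.curryLeft_compContinuousLinearMap _ _ _
    have h4 := ((h1.comp_contDiffWithinAt h3)).const_smul ((k : ℝ) + 1)⁻¹
    refine h4.congr_of_eventuallyEq (Filter.Eventually.of_forall fun z => ?_) ?_ <;>
    · simp only [Function.comp, ContinuousAlternatingMap.alternatizeUncurryFinCLM_apply,
        ContinuousAlternatingMap.alternatizeUncurryFin_curryLeft]
      rw [← Nat.cast_smul_eq_nsmul ℝ, smul_smul]
      push_cast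
      rw [inv_mul_cancel₀ (by positivity), one_smul]

section Wedge

set_option maxSynthPendingDepth 3

variable {E F V : Type*} [NormedAddCommGroup E] [NormedSpace ℝ E]
  [NormedAddCommGroup F] [NormedSpace ℝ F] [NormedAddCommGroup V] [NormedSpace ℝ V] {k : ℕ}

open ContinuousAlternatingMap (alternatizeUncurryFin alternatizeUncurryFinCLM)

/-- A `2`-form as a bilinear form. -/
noncomputable def bilin (a : E [⋀^Fin 2]→L[ℝ] ℝ) : E →L[ℝ] E →L[ℝ] ℝ :=
  ((ContinuousAlternatingMap.ofSubsingletonLIE (0 : Fin 1) :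
      (E →L[ℝ] ℝ) ≃ₗᵢ[ℝ] E [⋀^Fin 1]→L[ℝ] ℝ).symm.toContinuousLinearEquiv :
    (E [⋀^Fin 1]→L[ℝ] ℝ) →L[ℝ] (E →L[ℝ] ℝ)) ∘L a.curryLeft

lemma bilin_apply (a : E [⋀^Fin 2]→L[ℝ] ℝ) (x y : E) : bilin a x y = a ![x, y] := by
  change a _ = _
  congr 1
  funext i
  fin_cases i <;> rfl

/-- The map `(x, y) ↦ b (x, y) • w`. -/
noncomputable def bilinSMul {W : Type*} [NormedAddCommGroup W] [NormedSpace ℝ W]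
    (b : E →L[ℝ] E →L[ℝ] ℝ) (w : W) : E →L[ℝ] E →L[ℝ] W :=
  (ContinuousLinearMap.smulRightL ℝ E W).flip w ∘L b

lemma bilinSMul_apply {W : Type*} [NormedAddCommGroup W] [NormedSpace ℝ W]
    (b : E →L[ℝ] E →L[ℝ] ℝ) (w : W) (x y : E) : bilinSMul b w x y = b x y • w := rfl

/-- The wedge product `a ∧ w` of a `2`-form `a` and a `k`-form `w`,
as `a ∧ w = (1/2) ∑ᵢ eⁱ ∧ (ι(eᵢ) a ∧ w)`; see `twoWedge_apply` for the values. -/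
noncomputable def twoWedge (a : E [⋀^Fin 2]→L[ℝ] ℝ) (w : E [⋀^Fin k]→L[ℝ] V) :
    E [⋀^Fin (k + 2)]→L[ℝ] V :=
  (1 / 2 : ℝ) • alternatizeUncurryFin
    (alternatizeUncurryFinCLM ℝ E V ∘L bilinSMul (bilin a) w)

/-- The usual shuffle formula for the wedge product with a `2`-form. -/
lemma twoWedge_apply (a : E [⋀^Fin 2]→L[ℝ] ℝ) (w : E [⋀^Fin k]→L[ℝ] V) (v : Fin (k + 2) → E) :
    twoWedge a w v = ∑ i : Fin (k + 1), ∑ j ≥ i,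
      (-1 : ℤ) ^ (i + j : ℕ) • a ![v i.castSucc, v j.succ] •
        w (j.removeNth (i.castSucc.removeNth v)) := by
  have hsw : ∀ x y, a ![y, x] = - a ![x, y] := fun x y => by
    have := a.map_swap ![x, y] (i := 0) (j := 1) (by decide)
    refine Eq.trans ?_ this
    change a _ = a _
    congr 1
    funext i
    fin_cases i <;> rfl
  simp only [twoWedge, ContinuousAlternatingMap.smul_apply,
    ContinuousAlternatingMap.alternatizeUncurryFin_alternatizeUncurryFinCLM_comp_apply,
    Finset.smul_sum]
  refine Finset.sum_congr rfl fun i _ => Finset.sum_congr rfl fun j _ => ?_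
  rw [bilinSMul_apply, bilinSMul_apply, bilin_apply, bilin_apply, hsw (v i.castSucc),
    ContinuousAlternatingMap.smul_apply, ContinuousAlternatingMap.smul_apply]
  rw [smul_comm]
  congr 1
  module

lemma twoWedge_add (a : E [⋀^Fin 2]→L[ℝ] ℝ) (w w' : E [⋀^Fin k]→L[ℝ] V) :
    twoWedge a (w + w') = twoWedge a w + twoWedge a w' := by
  ext v
  simp only [twoWedge_apply, ContinuousAlternatingMap.add_apply, smul_add, Finset.sum_add_distrib]

lemma twoWedge_zero (a : E [⋀^Fin 2]→L[ℝ] ℝ) : twoWedge a (0 : E [⋀^Fin k]→L[ℝ] V) = 0 := by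
  ext v
  simp [twoWedge_apply]

lemma twoWedge_smul (a : E [⋀^Fin 2]→L[ℝ] ℝ) (c : ℂ) (w : E [⋀^Fin k]→L[ℝ] ℂ) :
    twoWedge a (c • w) = c • twoWedge a w := by
  ext v
  simp only [twoWedge_apply, ContinuousAlternatingMap.smul_apply, Finset.smul_sum]
  refine Finset.sum_congr rfl fun i _ => Finset.sum_congr rfl fun j _ => ?_
  rw [smul_comm c, smul_comm c]

lemma twoWedge_comp (a : E [⋀^Fin 2]→L[ℝ] ℝ) (w : E [⋀^Fin k]→L[ℝ] V) (L : F →L[ℝ] E) :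
    (twoWedge a w).compContinuousLinearMap L =
      twoWedge (a.compContinuousLinearMap L) (w.compContinuousLinearMap L) := by
  ext v
  rw [ContinuousAlternatingMap.compContinuousLinearMap_apply, twoWedge_apply, twoWedge_apply]
  refine Finset.sum_congr rfl fun i _ => Finset.sum_congr rfl fun j _ => ?_
  simp only [ContinuousAlternatingMap.compContinuousLinearMap_apply]
  congr 2
  congr 1
  funext i
  fin_cases i <;> rfl

lemma alt_flip (f : E →L[ℝ] E →L[ℝ] E [⋀^Fin k]→L[ℝ] V) :
    alternatizeUncurryFin (alternatizeUncurryFinCLM ℝ E V ∘L f.flip) =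
      - alternatizeUncurryFin (alternatizeUncurryFinCLM ℝ E V ∘L f) := by
  have h := ContinuousAlternatingMap.alternatizeUncurryFin_alternatizeUncurryFinCLM_comp_of_symmetric
    (f := f + f.flip) (fun x y => by simp [add_comm])
  rw [ContinuousLinearMap.comp_add, ContinuousAlternatingMap.alternatizeUncurryFin_add] at h
  exact eq_neg_of_add_eq_zero_right h

/-- Threefold alternation. -/
noncomputable def alt3 (g : E →L[ℝ] E →L[ℝ] E →L[ℝ] (E [⋀^Fin k]→L[ℝ] V)) :
    E [⋀^Fin (k + 3)]→L[ℝ] V :=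
  alternatizeUncurryFin (alternatizeUncurryFinCLM ℝ E V ∘L
    ((ContinuousLinearMap.compL ℝ E (E →L[ℝ] (E [⋀^Fin k]→L[ℝ] V)) (E [⋀^Fin (k + 1)]→L[ℝ] V)
      (alternatizeUncurryFinCLM ℝ E V)) ∘L g))

lemma alt3_add (g g' : E →L[ℝ] E →L[ℝ] E →L[ℝ] (E [⋀^Fin k]→L[ℝ] V)) :
    alt3 (g + g') = alt3 g + alt3 g' := by
  rw [alt3, ContinuousLinearMap.comp_add, ContinuousLinearMap.comp_add,
    ContinuousAlternatingMap.alternatizeUncurryFin_add]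
  rfl

lemma alt3_flip (g g' : E →L[ℝ] E →L[ℝ] E →L[ℝ] (E [⋀^Fin k]→L[ℝ] V))
    (h : ∀ x y, g' x y = g y x) : alt3 g' = - alt3 g := by
  rw [alt3, alt3, ← alt_flip]
  congr 2
  ext1 x
  ext1 y
  change alternatizeUncurryFinCLM ℝ E V (g' x y) = alternatizeUncurryFinCLM ℝ E V (g y x)
  rw [h]

lemma alt3_flip' (g g' : E →L[ℝ] E →L[ℝ] E →L[ℝ] (E [⋀^Fin k]→L[ℝ] V))
    (h : ∀ x y z, g' x y z = g x z y) : alt3 g' = - alt3 g := by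
  have e : alternatizeUncurryFinCLM ℝ E V ∘L
      ((ContinuousLinearMap.compL ℝ E (E →L[ℝ] (E [⋀^Fin k]→L[ℝ] V)) (E [⋀^Fin (k + 1)]→L[ℝ] V)
      (alternatizeUncurryFinCLM ℝ E V)) ∘L g') = - (alternatizeUncurryFinCLM ℝ E V ∘L
      ((ContinuousLinearMap.compL ℝ E (E →L[ℝ] (E [⋀^Fin k]→L[ℝ] V)) (E [⋀^Fin (k + 1)]→L[ℝ] V)
      (alternatizeUncurryFinCLM ℝ E V)) ∘L g)) := by
    ext1 x
    have h1 : g' x = (g x).flip := by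
      ext1 y; ext1 z; exact h x y z
    change alternatizeUncurryFin (alternatizeUncurryFinCLM ℝ E V ∘L g' x) =
      - alternatizeUncurryFin (alternatizeUncurryFinCLM ℝ E V ∘L g x)
    rw [h1, alt_flip]
  rw [alt3, alt3, e]
  exact map_neg (alternatizeUncurryFinCLM ℝ E V) _

/-- `bilin` as a continuous linear map. -/
noncomputable def bilinL : (E [⋀^Fin 2]→L[ℝ] ℝ) →L[ℝ] (E →L[ℝ] E →L[ℝ] ℝ) :=
  (ContinuousLinearMap.compL ℝ E (E [⋀^Fin 1]→L[ℝ] ℝ) (E →L[ℝ] ℝ)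
    ((ContinuousAlternatingMap.ofSubsingletonLIE (0 : Fin 1) :
      (E →L[ℝ] ℝ) ≃ₗᵢ[ℝ] E [⋀^Fin 1]→L[ℝ] ℝ).symm.toContinuousLinearEquiv :
      (E [⋀^Fin 1]→L[ℝ] ℝ) →L[ℝ] (E →L[ℝ] ℝ))) ∘L
    (ContinuousAlternatingMap.curryLeftLI (𝕜 := ℝ) (E := E) (F := ℝ) (n := 1)).toContinuousLinearMap

lemma bilinL_apply (a : E [⋀^Fin 2]→L[ℝ] ℝ) : bilinL a = bilin a := rfl

/-- The continuous linear map `f ↦ (1/2) Alt (Alt f)`. -/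
noncomputable def halfAlt : (E →L[ℝ] E →L[ℝ] (E [⋀^Fin k]→L[ℝ] V)) →L[ℝ] E [⋀^Fin (k + 2)]→L[ℝ] V :=
  (1 / 2 : ℝ) • (alternatizeUncurryFinCLM ℝ E V ∘L
    (ContinuousLinearMap.compL ℝ E (E →L[ℝ] (E [⋀^Fin k]→L[ℝ] V)) (E [⋀^Fin (k + 1)]→L[ℝ] V)
      (alternatizeUncurryFinCLM ℝ E V)))

lemma alt_halfAlt (g : E →L[ℝ] E →L[ℝ] E →L[ℝ] (E [⋀^Fin k]→L[ℝ] V)) :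
    alternatizeUncurryFin (halfAlt ∘L g) = (1 / 2 : ℝ) • alt3 g := by
  rw [alt3, ← ContinuousAlternatingMap.alternatizeUncurryFin_smul]
  rfl

lemma contDiffWithinAt_twoWedge {X : Type*} [NormedAddCommGroup X] [NormedSpace ℝ X]
    {n : WithTop ℕ∞} {s : Set X} {x : X} {a : X → E [⋀^Fin 2]→L[ℝ] ℝ} {w : X → E [⋀^Fin k]→L[ℝ] V}
    (ha : ContDiffWithinAt ℝ n a s x) (hw : ContDiffWithinAt ℝ n w s x) :
    ContDiffWithinAt ℝ n (fun y => twoWedge (a y) (w y)) s x := by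
  have h1 : ContDiffWithinAt ℝ n (fun y => bilinL (a y)) s x :=
    (ContinuousLinearMap.contDiff (F := E →L[ℝ] E →L[ℝ] ℝ) (bilinL (E := E))).comp_contDiffWithinAt ha
  have h2 : ContDiffWithinAt ℝ n
      (fun y => (ContinuousLinearMap.smulRightL ℝ E (E [⋀^Fin k]→L[ℝ] V)).flip (w y)) s x :=
    ((ContinuousLinearMap.smulRightL ℝ E (E [⋀^Fin k]→L[ℝ] V)).flip).contDiff.comp_contDiffWithinAt hw
  exact (halfAlt (E := E) (V := V) (k := k)).contDiff.comp_contDiffWithinAt (h2.clm_comp h1)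

lemma hasFDerivWithinAt_bilinSMul {W : Type*} [NormedAddCommGroup W] [NormedSpace ℝ W]
    {s : Set E} {x : E} {b : E → E →L[ℝ] E →L[ℝ] ℝ} {w : E → W}
    {b' : E →L[ℝ] E →L[ℝ] E →L[ℝ] ℝ} {w' : E →L[ℝ] W}
    (hb : HasFDerivWithinAt b b' s x) (hw : HasFDerivWithinAt w w' s x) :
    ∃ D1 D2 : E →L[ℝ] E →L[ℝ] E →L[ℝ] W, (∀ u y z, D1 u y z = b' u y z • w x) ∧
      (∀ u y z, D2 u y z = b x y z • w' u) ∧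
      HasFDerivWithinAt (fun y => bilinSMul (b y) (w y)) (D1 + D2) s x := by
  set S := (ContinuousLinearMap.smulRightL ℝ E W).flip with hS
  have h2 : HasFDerivWithinAt (fun y => S (w y)) (S ∘L w') s x :=
    S.hasFDerivAt.comp_hasFDerivWithinAt x hw
  have h3 := h2.clm_comp hb
  exact ⟨_, _, fun u y z => rfl, fun u y z => rfl, h3⟩

lemma alt3_cycle (D : E →L[ℝ] E →L[ℝ] E →L[ℝ] (E [⋀^Fin k]→L[ℝ] V)) :
    ∃ D' D'' : E →L[ℝ] E →L[ℝ] E →L[ℝ] (E [⋀^Fin k]→L[ℝ] V),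
      (∀ x y z, D' x y z = D y x z) ∧ (∀ x y z, D'' x y z = D z x y) ∧
      alt3 D' = - alt3 D ∧ alt3 D'' = alt3 D := by
  let D' : E →L[ℝ] E →L[ℝ] E →L[ℝ] (E [⋀^Fin k]→L[ℝ] V) :=
    ContinuousLinearMap.flip (F := E) (G := E →L[ℝ] (E [⋀^Fin k]→L[ℝ] V)) D
  let fl : (E →L[ℝ] E →L[ℝ] (E [⋀^Fin k]→L[ℝ] V)) →L[ℝ] (E →L[ℝ] E →L[ℝ] (E [⋀^Fin k]→L[ℝ] V)) :=
    (ContinuousLinearMap.flipₗᵢ ℝ E E (E [⋀^Fin k]→L[ℝ] V)).toContinuousLinearEquiv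
  let D'' : E →L[ℝ] E →L[ℝ] E →L[ℝ] (E [⋀^Fin k]→L[ℝ] V) := fl ∘L D'
  have h1 : alt3 D' = - alt3 D := alt3_flip _ _ (fun x y => rfl)
  have h2 : alt3 D'' = - alt3 D' := alt3_flip' _ _ (fun x y z => rfl)
  exact ⟨D', D'', fun _ _ _ => rfl, fun _ _ _ => rfl, h1, by rw [h2, h1, neg_neg]⟩

lemma alt3_bilin_eq_zero (a' : E →L[ℝ] E [⋀^Fin 2]→L[ℝ] ℝ) (ha : alternatizeUncurryFin a' = 0)
    (w : E [⋀^Fin k]→L[ℝ] V) (D : E →L[ℝ] E →L[ℝ] E →L[ℝ] (E [⋀^Fin k]→L[ℝ] V))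
    (hD : ∀ u y z, D u y z = a' u ![y, z] • w) : alt3 D = 0 := by
  obtain ⟨D', D'', h1, h2, e1, e2⟩ := alt3_cycle D
  have h3 : D + D'' = D' := by
    ext1 x
    ext1 y
    ext1 z
    change D x y z + D'' x y z = D' x y z
    rw [h1, h2, hD, hD, hD, ← add_smul]
    congr 1
    have h := congrArg (fun f => f ![x, y, z]) ha
    simp only [ContinuousAlternatingMap.alternatizeUncurryFin_apply] at h
    have r0 : Fin.removeNth 0 ![x, y, z] = ![y, z] := by
      funext i; fin_cases i <;> rfl
    have r1 : Fin.removeNth 1 ![x, y, z] = ![x, z] := by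
      funext i; fin_cases i <;> rfl
    have r2 : Fin.removeNth 2 ![x, y, z] = ![x, y] := by
      funext i; fin_cases i <;> rfl
    rw [show (∑ i : Fin (2 + 1), (-1 : ℤ) ^ (i : ℕ) • (a' (![x, y, z] i)) (i.removeNth ![x, y, z]))
      = _ from Fin.sum_univ_three _, r0, r1, r2] at h
    simp at h
    linarith
  have h4 := alt3_add D D''
  rw [h3, e1, e2] at h4
  have h5 : (3 : ℝ) • alt3 D = 0 := by
    have : (3 : ℝ) • alt3 D = (alt3 D + alt3 D) - (- alt3 D) := by module
    rw [this, ← h4, sub_self]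
  exact (smul_eq_zero.1 h5).resolve_left (by norm_num)

lemma alt3_bilin (a : E [⋀^Fin 2]→L[ℝ] ℝ)
    (w' : E →L[ℝ] E [⋀^Fin k]→L[ℝ] V) (D : E →L[ℝ] E →L[ℝ] E →L[ℝ] (E [⋀^Fin k]→L[ℝ] V))
    (hD : ∀ u y z, D u y z = a ![y, z] • w' u) :
    alt3 D = alternatizeUncurryFin (alternatizeUncurryFinCLM ℝ E V ∘L
      bilinSMul (bilin a) (alternatizeUncurryFin w')) := by
  obtain ⟨D', D'', h1, h2, e1, e2⟩ := alt3_cycle D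
  rw [← e2, alt3]
  congr 2
  ext1 x
  ext1 y
  rw [bilinSMul_apply, bilin_apply, ← ContinuousAlternatingMap.alternatizeUncurryFin_smul]
  change alternatizeUncurryFin (D'' x y) = _
  congr 1
  ext1 z
  rw [h2, hD]
  rfl

/-- The Leibniz rule `d (a ∧ w) = a ∧ dw` for a `2`-form `a` that is closed. -/
lemma extDerivWithin_twoWedge {s : Set E} {x : E} {a : E → E [⋀^Fin 2]→L[ℝ] ℝ}
    {w : E → E [⋀^Fin k]→L[ℝ] V} (hs : UniqueDiffWithinAt ℝ s x)
    (ha : DifferentiableWithinAt ℝ a s x) (hw : DifferentiableWithinAt ℝ w s x)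
    (hcl : extDerivWithin a s x = 0) :
    extDerivWithin (fun y => twoWedge (a y) (w y)) s x =
      twoWedge (a x) (extDerivWithin w s x) := by
  have h1 : HasFDerivWithinAt (fun y => bilin (a y)) (bilinL ∘L fderivWithin ℝ a s x) s x :=
    (ContinuousLinearMap.hasFDerivAt (F := E →L[ℝ] E →L[ℝ] ℝ)
      (bilinL (E := E))).comp_hasFDerivWithinAt x ha.hasFDerivWithinAt
  obtain ⟨D1, D2, hD1, hD2, h3⟩ := hasFDerivWithinAt_bilinSMul h1 hw.hasFDerivWithinAt
  have h4 := ((halfAlt (E := E) (V := V) (k := k)).hasFDerivAt.comp_hasFDerivWithinAt x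
    h3).fderivWithin hs
  have h5 : fderivWithin ℝ (fun y => twoWedge (a y) (w y)) s x = halfAlt ∘L (D1 + D2) := h4
  rw [extDerivWithin, h5, alt_halfAlt, alt3_add,
    alt3_bilin_eq_zero _ hcl (w x) D1 (fun u y z => (hD1 u y z).trans (by rw [← bilin_apply]; rfl)),
    alt3_bilin (a x) (fderivWithin ℝ w s x) D2
      (fun u y z => (hD2 u y z).trans (by rw [← bilin_apply])), zero_add]
  rfl

end Wedge

section Forms

variable {M N : CornerManifold.{u}} {V : Type} [NormedAddCommGroup V] [NormedSpace ℝ V] {k : ℕ}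

/-- The form read in the chart around `x₀`: its pull-back under the inverse of the chart. -/
noncomputable def inChart (η : RawForm M V k) (x₀ : M) : M.E → M.E [⋀^Fin k]→L[ℝ] V :=
  fun y => (η ((extChartAt M.I x₀).symm y)).compContinuousLinearMap
    (mfderivWithin 𝓘(ℝ, M.E) M.I (extChartAt M.I x₀).symm (Set.range M.I) y)

/-- Smoothness of a form: all its chart representatives are smooth. -/
def IsSmooth (η : RawForm M V k) : Prop :=
  ∀ x₀ : M, ContDiffOn ℝ ∞ (inChart η x₀) (extChartAt M.I x₀).target

/-- The exterior derivative: differentiate in the chart around the point. -/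
noncomputable def extD (η : RawForm M V k) : RawForm M V (k + 1) :=
  fun x => (extDerivWithin (inChart η x) (Set.range M.I)
    (extChartAt M.I x x)).compContinuousLinearMap (mfderiv M.I 𝓘(ℝ, M.E) (extChartAt M.I x) x)

/-- Pull-back of forms. -/
noncomputable def pull (f : M → N) (η : RawForm N V k) : RawForm M V k :=
  fun x => (η (f x)).compContinuousLinearMap (mfderiv M.I N.I f x)

lemma inChart_pull {f : M → N} (hf : ContMDiff M.I N.I ∞ f) (η : RawForm N V k)
    (x₀ : M) (y₀ : N) {y : M.E} (hy : y ∈ (extChartAt M.I x₀).target)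
    (hy' : f ((extChartAt M.I x₀).symm y) ∈ (extChartAt N.I y₀).source) :
    inChart (pull f η) x₀ y =
      (inChart η y₀ (extChartAt N.I y₀ (f ((extChartAt M.I x₀).symm y)))).compContinuousLinearMap
        (fderivWithin ℝ (fun z => extChartAt N.I y₀ (f ((extChartAt M.I x₀).symm z)))
          (Set.range M.I) y) := by
  have hU : UniqueMDiffWithinAt 𝓘(ℝ, M.E) (Set.range M.I) y :=
    (M.I.uniqueDiffOn _ (extChartAt_target_subset_range x₀ hy)).uniqueMDiffWithinAt
  have h1 := mdifferentiableWithinAt_extChartAt_symm (I := M.I) hy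
  have h2 : MDifferentiableAt M.I N.I f ((extChartAt M.I x₀).symm y) :=
    hf.mdifferentiableAt (by norm_num)
  have h3 : MDifferentiableAt N.I 𝓘(ℝ, N.E) (extChartAt N.I y₀) (f ((extChartAt M.I x₀).symm y)) :=
    mdifferentiableAt_extChartAt (by simpa using hy')
  have h23 := (h3.comp _ h2)
  have key : fderivWithin ℝ (fun z => extChartAt N.I y₀ (f ((extChartAt M.I x₀).symm z)))
      (Set.range M.I) y =
      (mfderiv N.I 𝓘(ℝ, N.E) (extChartAt N.I y₀) (f ((extChartAt M.I x₀).symm y))) ∘L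
      ((mfderiv M.I N.I f ((extChartAt M.I x₀).symm y)) ∘L
      (mfderivWithin 𝓘(ℝ, M.E) M.I (extChartAt M.I x₀).symm (Set.range M.I) y)) := by
    rw [← mfderivWithin_eq_fderivWithin]
    have e1 := mfderiv_comp_mfderivWithin y h23 h1 hU
    have e2 := mfderiv_comp _ h3 h2
    rw [e2] at e1
    exact e1
  have hinv := mfderivWithin_extChartAt_symm_comp_mfderiv_extChartAt' (I := N.I) hy'
  have aux : ∀ (p q : N) (_ : p = q) (a b : Fin k → N.E), a = b → η p a = η q b := by
    rintro p _ rfl a _ rfl; rfl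
  rw [key]
  ext v
  refine aux _ _ ((extChartAt N.I y₀).left_inv hy').symm _ _ (funext fun i => ?_)
  exact (congrArg (fun L : N.E →L[ℝ] N.E => L _) hinv).symm

lemma pull_id (η : RawForm M V k) : pull id η = η := by
  funext x
  ext v
  simp only [pull, mfderiv_id]
  rfl

lemma IsSmooth.contDiffWithinAt {η : RawForm M V k} (h : IsSmooth η) (x₀ : M) {y : M.E}
    (hy : y ∈ (extChartAt M.I x₀).target) :
    ContDiffWithinAt ℝ ∞ (inChart η x₀) (Set.range M.I) y :=
  (h x₀ y hy).mono_of_mem_nhdsWithin (extChartAt_target_mem_nhdsWithin_of_mem hy)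

lemma closure_interior_range {y : M.E} (hy : y ∈ Set.range M.I) :
    y ∈ closure (interior (Set.range M.I)) := by
  exact M.I.range_subset_closure_interior hy

lemma minSmooth : minSmoothness ℝ 2 ≤ (∞ : WithTop ℕ∞) := by
  simp only [minSmoothness_of_isRCLikeNormedField]
  exact WithTop.coe_le_coe.2 le_top

lemma contDiffWithinAt_coord {f : M → N} (hf : ContMDiff M.I N.I ∞ f)
    (x₀ : M) (y₀ : N) {y : M.E} (hy : y ∈ (extChartAt M.I x₀).target)
    (hy' : f ((extChartAt M.I x₀).symm y) ∈ (extChartAt N.I y₀).source) :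
    ContDiffWithinAt ℝ ∞ (fun z => extChartAt N.I y₀ (f ((extChartAt M.I x₀).symm z)))
      (Set.range M.I) y := by
  rw [← contMDiffWithinAt_iff_contDiffWithinAt]
  have h1 : ContMDiffWithinAt 𝓘(ℝ, M.E) M.I ∞ (extChartAt M.I x₀).symm (Set.range M.I) y :=
    contMDiffWithinAt_extChartAt_symm_range x₀ hy
  have h2 := (hf.contMDiffAt (x := (extChartAt M.I x₀).symm y)).comp_contMDiffWithinAt y h1
  have h3 : ContMDiffAt N.I 𝓘(ℝ, N.E) ∞ (extChartAt N.I y₀) (f ((extChartAt M.I x₀).symm y)) :=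
    contMDiffAt_extChartAt' (by simpa using hy')
  exact h3.comp_contMDiffWithinAt y h2

lemma eventually_mem {f : M → N} (hf : ContMDiff M.I N.I ∞ f)
    (x₀ : M) (y₀ : N) {y : M.E} (hy : y ∈ (extChartAt M.I x₀).target)
    (hy' : f ((extChartAt M.I x₀).symm y) ∈ (extChartAt N.I y₀).source) :
    ∀ᶠ z in nhdsWithin y (Set.range M.I), z ∈ (extChartAt M.I x₀).target ∧
      f ((extChartAt M.I x₀).symm z) ∈ (extChartAt N.I y₀).source := by
  refine Filter.Eventually.and (extChartAt_target_mem_nhdsWithin_of_mem hy) ?_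
  have h1 : ContMDiffWithinAt 𝓘(ℝ, M.E) M.I ∞ (extChartAt M.I x₀).symm (Set.range M.I) y :=
    contMDiffWithinAt_extChartAt_symm_range x₀ hy
  have h2 := (hf.contMDiffAt (x := (extChartAt M.I x₀).symm y)).comp_contMDiffWithinAt y h1
  exact h2.continuousWithinAt ((isOpen_extChartAt_source y₀).mem_nhds hy')

lemma inChart_pull_eventuallyEq {f : M → N} (hf : ContMDiff M.I N.I ∞ f) (η : RawForm N V k)
    (x₀ : M) (y₀ : N) {y : M.E} (hy : y ∈ (extChartAt M.I x₀).target)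
    (hy' : f ((extChartAt M.I x₀).symm y) ∈ (extChartAt N.I y₀).source) :
    inChart (pull f η) x₀ =ᶠ[nhdsWithin y (Set.range M.I)] fun y =>
      (inChart η y₀ (extChartAt N.I y₀ (f ((extChartAt M.I x₀).symm y)))).compContinuousLinearMap
        (fderivWithin ℝ (fun z => extChartAt N.I y₀ (f ((extChartAt M.I x₀).symm z)))
          (Set.range M.I) y) := by
  filter_upwards [eventually_mem hf x₀ y₀ hy hy'] with z hz
  exact inChart_pull hf η x₀ y₀ hz.1 hz.2

lemma extDerivWithin_inChart_pull {f : M → N} (hf : ContMDiff M.I N.I ∞ f) {η : RawForm N V k}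
    (hη : IsSmooth η) (x₀ : M) (y₀ : N) {y : M.E} (hy : y ∈ (extChartAt M.I x₀).target)
    (hy' : f ((extChartAt M.I x₀).symm y) ∈ (extChartAt N.I y₀).source) :
    extDerivWithin (inChart (pull f η) x₀) (Set.range M.I) y =
      (extDerivWithin (inChart η y₀) (Set.range N.I)
        (extChartAt N.I y₀ (f ((extChartAt M.I x₀).symm y)))).compContinuousLinearMap
        (fderivWithin ℝ (fun z => extChartAt N.I y₀ (f ((extChartAt M.I x₀).symm z)))
          (Set.range M.I) y) := by
  have hyr := extChartAt_target_subset_range x₀ hy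
  rw [(inChart_pull_eventuallyEq hf η x₀ y₀ hy hy').extDerivWithin_eq_of_mem hyr]
  refine extDerivWithin_pullback (r := ∞) ?_ (contDiffWithinAt_coord hf x₀ y₀ hy hy') minSmooth
    M.I.uniqueDiffOn (closure_interior_range hyr) hyr ?_
  · exact (hη.contDiffWithinAt y₀ ((extChartAt N.I y₀).map_source hy')).differentiableWithinAt
      (by norm_num)
  · intro z _
    simp

lemma inChart_extD {η : RawForm M V k} (hη : IsSmooth η) (x₀ : M) {y : M.E}
    (hy : y ∈ (extChartAt M.I x₀).target) :
    inChart (extD η) x₀ y = extDerivWithin (inChart η x₀) (Set.range M.I) y := by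
  set x := (extChartAt M.I x₀).symm y with hx
  have h0 := extDerivWithin_inChart_pull (f := id) contMDiff_id hη x₀ x hy
    (mem_extChartAt_source (I := M.I) x)
  rw [pull_id] at h0
  rw [h0]
  have hU : UniqueMDiffWithinAt 𝓘(ℝ, M.E) (Set.range M.I) y :=
    (M.I.uniqueDiffOn _ (extChartAt_target_subset_range x₀ hy)).uniqueMDiffWithinAt
  have h1 := mdifferentiableWithinAt_extChartAt_symm (I := M.I) hy
  have h3 : MDifferentiableAt M.I 𝓘(ℝ, M.E) (extChartAt M.I x) x :=
    mdifferentiableAt_extChartAt (by simp)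
  have key : fderivWithin ℝ (fun z => extChartAt M.I x (id ((extChartAt M.I x₀).symm z)))
      (Set.range M.I) y =
      (mfderiv M.I 𝓘(ℝ, M.E) (extChartAt M.I x) x) ∘L
      (mfderivWithin 𝓘(ℝ, M.E) M.I (extChartAt M.I x₀).symm (Set.range M.I) y) := by
    rw [← mfderivWithin_eq_fderivWithin]
    exact mfderiv_comp_mfderivWithin y h3 h1 hU
  rw [key]
  rfl

lemma IsSmooth.extD {η : RawForm M V k} (hη : IsSmooth η) : IsSmooth (extD η) := by
  intro x₀
  have h : ContDiffOn ℝ ∞ (fun y => extDerivWithin (inChart η x₀) (Set.range M.I) y)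
      (extChartAt M.I x₀).target := by
    intro y hy
    have h1 : ContDiffWithinAt ℝ ∞ (fderivWithin ℝ (inChart η x₀) (Set.range M.I))
        (Set.range M.I) y :=
      (hη.contDiffWithinAt x₀ hy).fderivWithin_right M.I.uniqueDiffOn (by norm_num)
        (extChartAt_target_subset_range x₀ hy)
    have h2 : ContDiff ℝ ∞ (ContinuousAlternatingMap.alternatizeUncurryFinCLM ℝ M.E V (n := k)) :=
      ContinuousLinearMap.contDiff _
    exact (h2.comp_contDiffWithinAt h1).mono (extChartAt_target_subset_range x₀)
  exact h.congr fun y hy => inChart_extD hη x₀ hy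

lemma extD_extD {η : RawForm M V k} (hη : IsSmooth η) : Deloc.extD (Deloc.extD η) = 0 := by
  funext x
  have hy := mem_extChartAt_target (I := M.I) x
  have hyr := extChartAt_target_subset_range x hy
  have h : inChart (Deloc.extD η) x =ᶠ[nhdsWithin (extChartAt M.I x x) (Set.range M.I)]
      extDerivWithin (inChart η x) (Set.range M.I) := by
    filter_upwards [extChartAt_target_mem_nhdsWithin_of_mem hy] with z hz
    exact inChart_extD hη x hz
  have h2 : extDerivWithin (inChart (Deloc.extD η) x) (Set.range M.I) (extChartAt M.I x x) = 0 := by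
    rw [h.extDerivWithin_eq_of_mem hyr]
    exact extDerivWithin_extDerivWithin_apply (hη.contDiffWithinAt x hy) minSmooth
      M.I.uniqueDiffOn (closure_interior_range hyr) hyr
  unfold Deloc.extD at h2 ⊢
  rw [h2]
  rfl

lemma IsSmooth.pull {f : M → N} (hf : ContMDiff M.I N.I ∞ f) {η : RawForm N V k}
    (hη : IsSmooth η) : IsSmooth (pull f η) := by
  intro x₀ y hy
  have hy' : f ((extChartAt M.I x₀).symm y) ∈
    (extChartAt N.I (f ((extChartAt M.I x₀).symm y))).source := mem_extChartAt_source _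
  have hyr := extChartAt_target_subset_range x₀ hy
  have h1 := contDiffWithinAt_coord hf x₀ _ hy hy'
  have h2 := hη.contDiffWithinAt _ ((extChartAt N.I _).map_source hy')
  refine ContDiffWithinAt.mono ?_ (extChartAt_target_subset_range x₀)
  refine ContDiffWithinAt.congr_of_eventuallyEq_of_mem ?_
    (inChart_pull_eventuallyEq hf η x₀ _ hy hy') hyr
  have h3 := h1.fderivWithin_right (m := ∞) M.I.uniqueDiffOn (by norm_num) hyr
  have h4 := h2.comp y h1 (fun z _ => by simp)
  exact contDiffWithinAt_altComp h4 h3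

lemma extD_pull {f : M → N} (hf : ContMDiff M.I N.I ∞ f) {η : RawForm N V k}
    (hη : IsSmooth η) : extD (pull f η) = pull f (extD η) := by
  funext x
  have hy := mem_extChartAt_target (I := M.I) x
  have hx : (extChartAt M.I x).symm (extChartAt M.I x x) = x := extChartAt_to_inv x
  have h := extDerivWithin_inChart_pull hf hη x (f x) hy (by rw [hx]; exact mem_extChartAt_source _)
  have key : fderivWithin ℝ (fun z => extChartAt N.I (f x) (f ((extChartAt M.I x).symm z)))
      (Set.range M.I) (extChartAt M.I x x) = mfderiv M.I N.I f x :=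
    (hf.mdifferentiableAt (by norm_num)).mfderiv.symm
  rw [key] at h
  have e1 : mfderiv M.I 𝓘(ℝ, M.E) (extChartAt M.I x) x = ContinuousLinearMap.id ℝ _ :=
    mfderiv_extChartAt_self
  have e2 : mfderiv N.I 𝓘(ℝ, N.E) (extChartAt N.I (f x)) (f x) = ContinuousLinearMap.id ℝ _ :=
    mfderiv_extChartAt_self
  ext v
  simp only [extD, pull, e1, e2]
  rw [h, hx]
  rfl

end Forms

section Forms2

variable {M N K : CornerManifold.{u}} {V : Type} [NormedAddCommGroup V] [NormedSpace ℝ V] {k : ℕ}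

lemma pull_comp {f : M → N} {g : N → K} (hf : ContMDiff M.I N.I ∞ f) (hg : ContMDiff N.I K.I ∞ g)
    (η : RawForm K V k) : pull f (pull g η) = pull (g ∘ f) η := by
  funext x
  have h : mfderiv M.I K.I (g ∘ f) x = (mfderiv N.I K.I g (f x)) ∘L (mfderiv M.I N.I f x) :=
    mfderiv_comp x (hg.mdifferentiableAt (by norm_num)) (hf.mdifferentiableAt (by norm_num))
  simp only [pull, h]
  rfl

/-- Pull-back under a surjective submersion is injective. -/
lemma pull_injective {f : M → N} (hf : Function.Surjective f)
    (hs : ∀ x, Function.Surjective (mfderiv M.I N.I f x)) {η η' : RawForm N V k}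
    (h : pull f η = pull f η') : η = η' := by
  funext y
  obtain ⟨x, rfl⟩ := hf y
  ext v
  choose w hw using fun i => hs x (v i)
  have := congrArg (fun (t : (TangentSpace M.I x) [⋀^Fin k]→L[ℝ] V) => t w) (congrFun h x)
  have e : (fun i => mfderiv M.I N.I f x (w i)) = v := funext hw
  rw [← e]
  exact this

lemma inChart_add (η η' : RawForm M V k) (x₀ : M) :
    inChart (η + η') x₀ = inChart η x₀ + inChart η' x₀ := rfl

lemma inChart_smul (c : ℂ) (η : RawForm M ℂ k) (x₀ : M) :
    inChart (c • η) x₀ = c • inChart η x₀ := rfl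

lemma IsSmooth.add {η η' : RawForm M V k} (h : IsSmooth η) (h' : IsSmooth η') :
    IsSmooth (η + η') := fun x₀ => (h x₀).add (h' x₀)

lemma IsSmooth.zero : IsSmooth (0 : RawForm M V k) :=
  fun _ => contDiffOn_const (c := (0 : M.E [⋀^Fin k]→L[ℝ] V))

lemma IsSmooth.smul (c : ℂ) {η : RawForm M ℂ k} (h : IsSmooth η) : IsSmooth (c • η) :=
  fun x₀ => (h x₀).const_smul c

lemma extD_add {η η' : RawForm M V k} (h : IsSmooth η) (h' : IsSmooth η') :
    extD (η + η') = extD η + extD η' := by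
  funext x
  have hy := mem_extChartAt_target (I := M.I) x
  have hU := M.I.uniqueDiffOn _ (extChartAt_target_subset_range x hy)
  simp only [extD, inChart_add, Pi.add_apply]
  rw [extDerivWithin_add hU ((h.contDiffWithinAt x hy).differentiableWithinAt (by norm_num))
    ((h'.contDiffWithinAt x hy).differentiableWithinAt (by norm_num))]
  rfl

lemma extD_smul (c : ℂ) {η : RawForm M ℂ k} (h : IsSmooth η) :
    extD (c • η) = c • extD η := by
  funext x
  have hy := mem_extChartAt_target (I := M.I) x
  have hU := M.I.uniqueDiffOn _ (extChartAt_target_subset_range x hy)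
  have hd := (h.contDiffWithinAt x hy).differentiableWithinAt (by norm_num : (∞ : WithTop ℕ∞) ≠ 0)
  simp only [extD, inChart_smul, Pi.smul_apply, extDerivWithin]
  rw [fderivWithin_const_smul hU hd, ContinuousAlternatingMap.alternatizeUncurryFin_smul]
  rfl

/-- The wedge product of a `2`-form with a form. -/
noncomputable def wedgeForm (a : RawForm M ℝ 2) (η : RawForm M V k) : RawForm M V (k + 2) :=
  fun x => twoWedge (E := M.E) (a x) (η x)

lemma inChart_wedgeForm (a : RawForm M ℝ 2) (η : RawForm M V k) (x₀ : M) :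
    inChart (wedgeForm a η) x₀ = fun y => twoWedge (inChart a x₀ y) (inChart η x₀ y) := by
  funext y
  exact twoWedge_comp (E := M.E) (F := M.E) _ _ _

lemma IsSmooth.wedgeForm {a : RawForm M ℝ 2} {η : RawForm M V k} (ha : IsSmooth a)
    (h : IsSmooth η) : IsSmooth (wedgeForm a η) := by
  intro x₀
  rw [inChart_wedgeForm]
  exact fun y hy => contDiffWithinAt_twoWedge (ha x₀ y hy) (h x₀ y hy)

lemma extD_wedgeForm {a : RawForm M ℝ 2} {η : RawForm M V k} (ha : IsSmooth a)
    (h : IsSmooth η) (hcl : extD a = 0) :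
    extD (Deloc.wedgeForm a η) = Deloc.wedgeForm a (extD η) := by
  funext x
  have hy := mem_extChartAt_target (I := M.I) x
  have hU := M.I.uniqueDiffOn _ (extChartAt_target_subset_range x hy)
  have e1 : mfderiv M.I 𝓘(ℝ, M.E) (extChartAt M.I x) x = ContinuousLinearMap.id ℝ _ :=
    mfderiv_extChartAt_self
  have e2 : ∀ {W : Type} [NormedAddCommGroup W] [NormedSpace ℝ W] {l : ℕ} (b : RawForm M W l),
      extD b x = extDerivWithin (inChart b x) (Set.range M.I) (extChartAt M.I x x) := by
    intro W _ _ l b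
    simp only [extD, e1]
    rfl
  have e3 : ∀ {W : Type} [NormedAddCommGroup W] [NormedSpace ℝ W] {l : ℕ} (b : RawForm M W l),
      inChart b x (extChartAt M.I x x) = b x := by
    intro W _ _ l b
    have e4 : mfderivWithin 𝓘(ℝ, M.E) M.I (extChartAt M.I x).symm (Set.range M.I)
        (extChartAt M.I x x) = ContinuousLinearMap.id ℝ _ := mfderivWithin_range_extChartAt_symm
    simp only [inChart, e4]
    ext v
    change b ((extChartAt M.I x).symm (extChartAt M.I x x)) v = b x v
    have aux : ∀ (p q : M) (_ : p = q) (v : Fin l → M.E), b p v = b q v := by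
      rintro p _ rfl _; rfl
    exact aux _ _ (extChartAt_to_inv x) v
  have hcl' : extDerivWithin (inChart a x) (Set.range M.I) (extChartAt M.I x x) = 0 := by
    rw [← e2, hcl]; rfl
  have key := extDerivWithin_twoWedge (E := M.E) hU
    ((ha.contDiffWithinAt x hy).differentiableWithinAt (by norm_num))
    ((h.contDiffWithinAt x hy).differentiableWithinAt (by norm_num)) hcl'
  rw [e2, inChart_wedgeForm, key, e3]
  rw [Deloc.wedgeForm, e2]

lemma pull_wedgeForm (f : M → N) (a : RawForm N ℝ 2) (η : RawForm N V k) :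
    pull f (wedgeForm a η) = wedgeForm (pull f a) (pull f η) := by
  funext x
  exact twoWedge_comp (E := N.E) (F := M.E) _ _ _

end Forms2

section Total

variable (M N : CornerManifold.{u})

/-- Smooth complex-valued `k`-forms. -/
noncomputable def Form (k : ℕ) : Submodule ℂ (RawForm M ℂ k) where
  carrier := {η | IsSmooth η}
  add_mem' h h' := h.add h'
  zero_mem' := IsSmooth.zero
  smul_mem' c _ h := h.smul c

/-- Smooth real `2`-forms. -/
abbrev TwoForm : Type u := {a : RawForm M ℝ 2 // IsSmooth a}

/-- Smooth complex differential forms of all degrees (forms of degree above the dimension vanish,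
so this is the direct sum over all degrees). -/
abbrev TotalForm : Type u := (k : ℕ) → Form M k

variable {M N}

/-- The exterior derivative on smooth complex `k`-forms. -/
noncomputable def dForm (k : ℕ) : Form M k →ₗ[ℂ] Form M (k + 1) where
  toFun η := ⟨extD η.1, IsSmooth.extD η.2⟩
  map_add' η η' := Subtype.ext (extD_add η.2 η'.2)
  map_smul' c η := Subtype.ext (extD_smul c η.2)

/-- The deRham differential. -/
noncomputable def dTotal : TotalForm M →ₗ[ℂ] TotalForm M where
  toFun u k := match k with
    | 0 => 0
    | k + 1 => dForm k (u k)
  map_add' u v := by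
    funext k
    cases k with
    | zero => simp
    | succ k => exact map_add (dForm k) _ _
  map_smul' c u := by
    funext k
    cases k with
    | zero => simp
    | succ k => exact map_smul (dForm k) _ _

lemma dTotal_dTotal (u : TotalForm M) : dTotal (dTotal u) = 0 := by
  funext k
  match k with
  | 0 => rfl
  | 1 => exact map_zero (dForm 0)
  | k + 2 => exact Subtype.ext (extD_extD (u k).2)

/-- The operator `u ↦ a ∧ u` for a `2`-form `a`. -/
noncomputable def wedgeTotal (a : TwoForm M) : TotalForm M →ₗ[ℂ] TotalForm M where
  toFun u k := match k with
    | 0 => 0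
    | 1 => 0
    | k + 2 => ⟨wedgeForm a.1 (u k).1, a.2.wedgeForm (u k).2⟩
  map_add' u v := by
    funext k
    match k with
    | 0 => simp
    | 1 => simp
    | k + 2 => exact Subtype.ext (funext fun x => twoWedge_add (E := M.E) _ _ _)
  map_smul' c u := by
    funext k
    match k with
    | 0 => simp
    | 1 => simp
    | k + 2 => exact Subtype.ext (funext fun x => twoWedge_smul (E := M.E) _ _ _)

lemma wedgeTotal_dTotal {a : TwoForm M} (ha : extD a.1 = 0) (u : TotalForm M) :
    dTotal (wedgeTotal a u) = wedgeTotal a (dTotal u) := by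
  funext k
  match k with
  | 0 => rfl
  | 1 => exact map_zero (dForm 0)
  | 2 =>
    refine (map_zero (dForm 1)).trans ?_
    exact Subtype.ext (funext fun x => (twoWedge_zero (E := M.E) (V := ℂ) (k := 0) (a.1 x)).symm)
  | k + 3 => exact Subtype.ext (extD_wedgeForm a.2 (u k).2 ha)

/-- The operator `u ↦ exp (a / 2π) ∧ u` for a `2`-form `a`; only the terms with `2 j ≤ k`
contribute in degree `k`. -/
noncomputable def expWedge (a : TwoForm M) : TotalForm M →ₗ[ℂ] TotalForm M where
  toFun u k := ∑ j ∈ Finset.range (k + 1),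
    ((2 * Real.pi : ℂ) ^ j * (j.factorial : ℂ))⁻¹ • ((wedgeTotal a ^ j) u) k
  map_add' u v := by
    funext k
    simp [Finset.sum_add_distrib]
  map_smul' c u := by
    funext k
    simp only [map_smul, Pi.smul_apply, Finset.smul_sum, RingHom.id_apply]
    exact Finset.sum_congr rfl fun j _ => smul_comm _ _ _

lemma wedgeTotal_pow_eq_zero (a : TwoForm M) (u : TotalForm M) (j k : ℕ) (h : k < 2 * j) :
    ((wedgeTotal a ^ j) u) k = 0 := by
  induction j generalizing k with
  | zero => omega
  | succ j ih =>
    rw [pow_succ', Module.End.mul_apply]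
    match k with
    | 0 => rfl
    | 1 => rfl
    | k + 2 =>
      refine Subtype.ext (funext fun x => ?_)
      have h0 := ih k (by omega)
      change twoWedge (E := M.E) (a.1 x) (((wedgeTotal a ^ j) u k).1 x) = 0
      rw [h0]
      exact twoWedge_zero (E := M.E) (a.1 x)

lemma expWedge_dTotal {a : TwoForm M} (ha : extD a.1 = 0) (u : TotalForm M) :
    dTotal (expWedge a u) = expWedge a (dTotal u) := by
  have hp : ∀ j, dTotal ((wedgeTotal a ^ j) u) = (wedgeTotal a ^ j) (dTotal u) := by
    intro j
    induction j with
    | zero => rfl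
    | succ j ih =>
      rw [pow_succ', Module.End.mul_apply, wedgeTotal_dTotal ha, ih]
      rfl
  funext k
  cases k with
  | zero =>
    have : (dTotal u) 0 = 0 := rfl
    change (0 : Form M 0) = ∑ j ∈ Finset.range 1, _
    simp [this]
  | succ k =>
    change dForm k (∑ j ∈ Finset.range (k + 1), _) = ∑ j ∈ Finset.range (k + 1 + 1), _
    rw [Finset.sum_range_succ _ (k + 1), wedgeTotal_pow_eq_zero _ _ _ _ (by omega), smul_zero,
      add_zero, map_sum]
    refine Finset.sum_congr rfl fun j _ => ?_
    rw [map_smul, ← hp]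
    rfl

/-- Smooth maps between manifolds with corners. -/
abbrev SmoothMap (M N : CornerManifold.{u}) : Type u := ContMDiffMap M.I N.I M N ∞

/-- Pull-back of a real `2`-form. -/
noncomputable def pullTwo (f : SmoothMap M N) (a : TwoForm N) : TwoForm M :=
  ⟨pull f a.1, a.2.pull f.contMDiff⟩

/-- Pull-back of smooth complex forms. -/
noncomputable def pullForm (f : SmoothMap M N) (k : ℕ) : Form N k →ₗ[ℂ] Form M k where
  toFun η := ⟨pull f η.1, IsSmooth.pull f.contMDiff η.2⟩
  map_add' _ _ := rfl
  map_smul' _ _ := rfl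

/-- Pull-back of smooth complex forms of all degrees. -/
noncomputable def pullTotal (f : SmoothMap M N) : TotalForm N →ₗ[ℂ] TotalForm M :=
  LinearMap.pi fun k => pullForm f k ∘ₗ LinearMap.proj k

lemma pullTotal_dTotal (f : SmoothMap M N) (u : TotalForm N) :
    pullTotal f (dTotal u) = dTotal (pullTotal f u) := by
  funext k
  cases k with
  | zero => rfl
  | succ k => exact Subtype.ext (extD_pull f.contMDiff (u k).2).symm

lemma pullTotal_expWedge (f : SmoothMap M N) (a : TwoForm N) (u : TotalForm N) :
    pullTotal f (expWedge a u) = expWedge (pullTwo f a) (pullTotal f u) := by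
  have h1 : ∀ u, pullTotal f (wedgeTotal a u) = wedgeTotal (pullTwo f a) (pullTotal f u) := by
    intro u
    funext k
    match k with
    | 0 => rfl
    | 1 => rfl
    | k + 2 => exact Subtype.ext (pull_wedgeForm f a.1 (u k).1)
  have hp : ∀ j, pullTotal f ((wedgeTotal a ^ j) u) =
      (wedgeTotal (pullTwo f a) ^ j) (pullTotal f u) := by
    intro j
    induction j with
    | zero => rfl
    | succ j ih =>
      rw [pow_succ', pow_succ', Module.End.mul_apply, Module.End.mul_apply, h1, ih]
  funext k
  change pullForm f k (∑ j ∈ Finset.range (k + 1), _) = ∑ j ∈ Finset.range (k + 1), _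
  rw [map_sum]
  refine Finset.sum_congr rfl fun j _ => ?_
  rw [map_smul, ← hp]
  rfl

/-- The forms all of whose components have degree congruent to `ε` modulo `2`. -/
def parityForm (M : CornerManifold.{u}) (ε : ZMod 2) : Submodule ℂ (TotalForm M) where
  carrier := {u | ∀ k : ℕ, (k : ZMod 2) ≠ ε → u k = 0}
  add_mem' h h' k hk := by rw [Pi.add_apply, h k hk, h' k hk, add_zero]
  zero_mem' _ _ := rfl
  smul_mem' c u h k hk := by rw [Pi.smul_apply, h k hk, smul_zero]

lemma dTotal_mem_parity {ε : ZMod 2} {u : TotalForm M} (hu : u ∈ parityForm M ε) :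
    dTotal u ∈ parityForm M (ε + 1) := by
  intro k hk
  cases k with
  | zero => rfl
  | succ k =>
    change dForm k (u k) = 0
    rw [hu k (fun h => hk (by push_cast; rw [h])), map_zero]

end Total

section Twisted

variable {G : Type v} [CommGroup G] [TopologicalSpace G]

/-- The characters of `G` that are trivial on `B`, that is, the characters of `G / B`. -/
def annihilator (B : Subgroup G) : Subgroup (PontryaginDual G) where
  carrier := {χ | ∀ b ∈ B, χ b = 1}
  mul_mem' {χ χ'} h h' b hb := by
    change χ b * χ' b = 1
    rw [h b hb, h' b hb, one_mul]
  one_mem' _ _ := rfl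
  inv_mem' {χ} h b hb := by
    change (χ b)⁻¹ = 1
    rw [h b hb, inv_one]

variable (G) in
/-- A group of characters of `G`, each with a closed real `2`-form `F` on `M`, such that the Chern
character of the line bundle defined by the character is `exp (F / 2π)`. -/
structure Twist (M : CornerManifold.{u}) where
  chars : Subgroup (PontryaginDual G)
  curv : chars → TwoForm M
  closed : ∀ χ, extD (curv χ).1 = 0

/-- Pull-back of the curvature forms. -/
noncomputable def Twist.pull {M N : CornerManifold.{u}} (f : SmoothMap M N) (T : Twist G N) :
    Twist G M where
  chars := T.chars
  curv χ := pullTwo f (T.curv χ)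
  closed χ := by
    refine (extD_pull f.contMDiff (T.curv χ).2).trans ?_
    rw [T.closed]
    rfl

variable {M N : CornerManifold.{u}}

noncomputable instance : AddCommGroup (TotalForm M) := Pi.addCommGroup

noncomputable instance : Module ℂ (TotalForm M) := Pi.module _ _ _

variable (G M) in
/-- The finite sums `∑ uᵢ ⊗ gᵢ` of formal products of forms with characters of `G`. -/
abbrev FormSum : Type (max u v) := PontryaginDual G →₀ TotalForm M

noncomputable instance : AddCommGroup (FormSum G M) := Finsupp.instAddCommGroup

noncomputable instance : Module ℂ (FormSum G M) := Finsupp.module _ _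

/-- The subspace spanned by the relations `u ⊗ g ≃ (Ch(χ) ∧ u) ⊗ χ g`. -/
noncomputable def twistRel (T : Twist G M) : Submodule ℂ (FormSum G M) :=
  Submodule.span ℂ {f | ∃ (χ : T.chars) (g : PontryaginDual G) (u : TotalForm M),
    f = Finsupp.single g u - Finsupp.single (χ.1 * g) (expWedge (T.curv χ) u)}

/-- The space of twisted (delocalized) forms. -/
abbrev TwistedForm (T : Twist G M) : Type (max u v) := FormSum G M ⧸ twistRel T

noncomputable instance (T : Twist G M) : AddCommGroup (TwistedForm T) :=
  Submodule.Quotient.addCommGroup _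

noncomputable instance (T : Twist G M) : Module ℂ (TwistedForm T) :=
  Submodule.Quotient.module _

variable (G) in
/-- The differential on finite sums, `u ⊗ g ↦ du ⊗ g`. -/
noncomputable def sumD : FormSum G M →ₗ[ℂ] FormSum G M :=
  Finsupp.mapRange.linearMap (dTotal (M := M))

variable (G) in
/-- The pull-back of finite sums, `u ⊗ g ↦ f^*u ⊗ g`. -/
noncomputable def sumPull (f : SmoothMap M N) : FormSum G N →ₗ[ℂ] FormSum G M :=
  Finsupp.mapRange.linearMap (pullTotal f)

lemma sumD_single (g : PontryaginDual G) (u : TotalForm M) :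
    sumD G (Finsupp.single g u) = Finsupp.single g (dTotal u) :=
  Finsupp.mapRange_single (hf := map_zero dTotal)

lemma sumPull_single (f : SmoothMap M N) (g : PontryaginDual G) (u : TotalForm N) :
    sumPull G f (Finsupp.single g u) = Finsupp.single g (pullTotal f u) :=
  Finsupp.mapRange_single (hf := map_zero (pullTotal f))

/-- The differential on twisted forms, `u ⊗ g ↦ du ⊗ g`. -/
noncomputable def twistD (T : Twist G M) : TwistedForm T →ₗ[ℂ] TwistedForm T :=
  Submodule.mapQ _ _ (sumD G) (by
    refine Submodule.span_le.2 ?_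
    rintro _ ⟨χ, g, u, rfl⟩
    refine Submodule.subset_span ⟨χ, g, dTotal u, ?_⟩
    rw [map_sub, sumD_single, sumD_single, expWedge_dTotal (T.closed χ)])

/-- Pull-back of twisted forms, `u ⊗ g ↦ f^*u ⊗ g`, under a map for which the characters in use
on the target are in use on the source, with the pulled-back curvature. -/
noncomputable def twistPull (f : SmoothMap M N) (T : Twist G M) (S : Twist G N)
    (h : ∀ χ : S.chars, ∃ hχ : χ.1 ∈ T.chars, T.curv ⟨χ.1, hχ⟩ = pullTwo f (S.curv χ)) :
    TwistedForm S →ₗ[ℂ] TwistedForm T :=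
  Submodule.mapQ _ _ (sumPull G f) (by
    refine Submodule.span_le.2 ?_
    rintro _ ⟨χ, g, u, rfl⟩
    obtain ⟨hχ, e⟩ := h χ
    refine Submodule.subset_span ⟨⟨χ.1, hχ⟩, g, pullTotal f u, ?_⟩
    rw [map_sub, sumPull_single, sumPull_single, pullTotal_expWedge, e])

lemma twistD_twistD (T : Twist G M) (u : TwistedForm T) : twistD T (twistD T u) = 0 := by
  obtain ⟨f, rfl⟩ := Submodule.mkQ_surjective _ u
  have h : sumD G (sumD G f) = 0 := by
    ext1 g
    exact dTotal_dTotal (f g)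
  change Submodule.mkQ (twistRel T) (sumD G (sumD G f)) = 0
  rw [h, map_zero]

lemma twistPull_twistD (f : SmoothMap M N) (T : Twist G M) (S : Twist G N)
    (h : ∀ χ : S.chars, ∃ hχ : χ.1 ∈ T.chars, T.curv ⟨χ.1, hχ⟩ = pullTwo f (S.curv χ))
    (u : TwistedForm S) : twistPull f T S h (twistD S u) = twistD T (twistPull f T S h u) := by
  obtain ⟨a, rfl⟩ := Submodule.mkQ_surjective _ u
  have e : sumPull G f (sumD G a) = sumD G (sumPull G f a) := by
    ext1 g
    exact pullTotal_dTotal f (a g)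
  exact congrArg (Submodule.mkQ (twistRel T)) e

/-- The even (`ε = 0`) and the odd (`ε = 1`) twisted forms. -/
noncomputable def twistParity (T : Twist G M) (ε : ZMod 2) : Submodule ℂ (TwistedForm T) :=
  Submodule.map (Submodule.mkQ (twistRel T))
    { carrier := {f | ∀ g, f g ∈ parityForm M ε}
      add_mem' := fun h h' g => add_mem (h g) (h' g)
      zero_mem' := fun _ => zero_mem _
      smul_mem' := fun c _ h g => Submodule.smul_mem _ c (h g) }

lemma twistD_mem_parity {T : Twist G M} {ε : ZMod 2} {u : TwistedForm T}
    (hu : u ∈ twistParity T ε) : twistD T u ∈ twistParity T (ε + 1) := by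
  obtain ⟨f, hf, rfl⟩ := hu
  exact ⟨sumD G f, fun g => dTotal_mem_parity (hf g), rfl⟩

end Twisted

section Iterated

variable {M N : CornerManifold.{u}}

/-- A fibration of compact manifolds with corners: a smooth surjective map that is locally, over
the base, the projection of a product. -/
structure IsFibration (f : SmoothMap M N) : Prop where
  surjective : Function.Surjective f
  locally_trivial : ∀ y : N, ∃ (Z : CornerManifold.{u}) (e : OpenPartialHomeomorph M (N × Z))
    (U : Set N), IsOpen U ∧ y ∈ U ∧ e.source = f ⁻¹' U ∧ e.target = U ×ˢ Set.univ ∧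
      ContMDiffOn M.I (N.I.prod Z.I) ∞ e e.source ∧
      ContMDiffOn (N.I.prod Z.I) M.I ∞ e.symm e.target ∧ ∀ x ∈ e.source, (e x).1 = f x

lemma IsFibration.surjective_mfderiv {f : SmoothMap M N} (hf : IsFibration f) (x : M) :
    Function.Surjective (mfderiv M.I N.I f x) := by
  obtain ⟨Z, e, U, hU, hy, hs, ht, he, he', hf1⟩ := hf.locally_trivial (f x)
  have hx : x ∈ e.source := by rw [hs]; exact hy
  let s : N → M := fun y => e.symm (y, (e x).2)
  have hex : (f x, (e x).2) = e x := by rw [← hf1 x hx]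
  have hsx : s (f x) = x := by
    change e.symm (f x, (e x).2) = x
    rw [hex, e.left_inv hx]
  have h1 : ContMDiffAt N.I (N.I.prod Z.I) ∞ (fun y : N => (y, (e x).2)) (f x) :=
    contMDiffAt_id.prodMk contMDiffAt_const
  have h2 : ContMDiffAt (N.I.prod Z.I) M.I ∞ e.symm (f x, (e x).2) :=
    he'.contMDiffAt (e.open_target.mem_nhds (by rw [hex]; exact e.map_source hx))
  have h3 : ContMDiffAt N.I M.I ∞ s (f x) := h2.comp (f x) h1
  have h4 : MDifferentiableAt N.I M.I s (f x) := h3.mdifferentiableAt (by norm_num)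
  have h5 : MDifferentiableAt M.I N.I f (s (f x)) := f.contMDiff.mdifferentiableAt (by norm_num)
  have h6 : (f ∘ s) =ᶠ[nhds (f x)] id := by
    filter_upwards [hU.mem_nhds hy] with y hyU
    have ht' : (y, (e x).2) ∈ e.target := by rw [ht]; exact ⟨hyU, trivial⟩
    change f (e.symm (y, (e x).2)) = y
    rw [← hf1 _ (e.map_target ht'), e.right_inv ht']
  have h7 := mfderiv_comp (f x) h5 h4
  rw [h6.mfderiv_eq, mfderiv_id, hsx] at h7
  intro v
  refine ⟨mfderiv N.I M.I s (f x) v, ?_⟩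
  exact (congrArg (fun L : N.E →L[ℝ] N.E => L v) h7).symm

/-- The inclusion of a collective boundary hypersurface: an injective smooth map given, in suitable
charts, by the inclusion of a face `{x_j = 0}`. -/
structure IsBoundaryFace (i : SmoothMap M N) : Prop where
  injective : Function.Injective i
  charts : ∀ p : M, ∃ e ∈ IsManifold.maximalAtlas M.I ∞ M, ∃ e' ∈ IsManifold.maximalAtlas N.I ∞ N,
    ∃ (j : Fin N.dim) (σ : Fin M.dim → Fin N.dim), p ∈ e.source ∧
      Set.MapsTo i e.source e'.source ∧ Function.Injective σ ∧ Set.range σ = {j}ᶜ ∧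
      ∀ q ∈ e.source, (e' (i q)).1 j = 0 ∧ ∀ m, (e' (i q)).1 (σ m) = (e q).1 m

/-- An iterated space over the finite poset `A`, where `face α β`, for `α < β`, is the collective
boundary hypersurface `H_β(X_α)` of `X_α`, `incl` is its inclusion into `X_α` and
`fib` the fibration `H_β(X_α) → X_β`. -/
structure IteratedSpace (A : Type w) [PartialOrder A] where
  space : A → CornerManifold.{u}
  face : ∀ α β : A, α < β → CornerManifold.{u}
  incl : ∀ {α β : A} (h : α < β), SmoothMap (face α β h) (space α)
  fib : ∀ {α β : A} (h : α < β), SmoothMap (face α β h) (space β)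
  nonempty : ∀ α, Nonempty (space α)
  isBoundaryFace : ∀ {α β : A} (h : α < β), IsBoundaryFace (incl h)
  isFibration : ∀ {α β : A} (h : α < β), IsFibration (fib h)
  /-- The boundary hypersurfaces of `X_α` are partitioned into the collective ones: near each point
  of `X_α` the hypersurfaces `H_β(X_α)` through it are the sets `{x_j = 0}` for different boundary
  coordinates `x_j`, and there is no other boundary. -/
  boundary : ∀ α (p : space α), ∃ e ∈ IsManifold.maximalAtlas (space α).I ∞ (space α),
    ∃ c : A → Fin (space α).dim → Prop, p ∈ e.source ∧
      (∀ β (h : α < β), p ∈ Set.range (incl h) → ∃! j, c β j) ∧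
      (∀ β β' j, c β j → c β' j → β = β') ∧
      (∀ β j, c β j → ∃ h : α < β, p ∈ Set.range (incl h)) ∧
      ∀ q ∈ e.source, (∀ β (h : α < β), q ∈ Set.range (incl h) ↔ ∃ j, c β j ∧ (e q).1 j = 0) ∧
        ∀ j, (∀ β, ¬ c β j) → 0 < (e q).1 j
  /-- Two collective boundary hypersurfaces meet if and only if they are related. -/
  meet_iff : ∀ {α β γ : A} (h : α < β) (h' : α < γ),
    (Set.range (incl h) ∩ Set.range (incl h')).Nonempty ↔ β ≤ γ ∨ γ ≤ β
  /-- `H_γ(X_β)` is the image of `H_γ(X_α) ∩ H_β(X_α)` under the fibration. -/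
  image_face : ∀ {α β γ : A} (h : α < β) (h' : β < γ),
    fib h '' (incl h ⁻¹' Set.range (incl (h.trans h'))) = Set.range (incl h')
  /-- On `H_β(X_α) ∩ H_γ(X_α)` the fibration to `X_γ` factors through the one to `X_β`. -/
  fib_fib : ∀ {α β γ : A} (h : α < β) (h' : β < γ) (p : face α β h) (r : face α γ (h.trans h'))
    (s : face β γ h'), incl h p = incl (h.trans h') r → incl h' s = fib h p →
      fib h' s = fib (h.trans h') r

end Iterated

section Action

variable (A : Type w) [PartialOrder A] (d : ℕ) (G : Type v) [CommGroup G] [TopologicalSpace G]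
  [ChartedSpace (EuclideanSpace ℝ (Fin d)) G]

variable {A} in
/-- A smooth action of `G` on an iterated space. Since each collective boundary hypersurface is
invariant and its elements are disjoint, the action is boundary free. -/
structure SmoothAction (X : IteratedSpace.{u} A) where
  act : ∀ α, G →* Equiv.Perm (X.space α)
  actFace : ∀ {α β : A} (h : α < β), G →* Equiv.Perm (X.face α β h)
  smooth : ∀ α, ContMDiff ((𝓡 d).prod (X.space α).I) (X.space α).I ∞
    (fun p : G × X.space α => act α p.1 p.2)
  smoothFace : ∀ {α β : A} (h : α < β), ContMDiff ((𝓡 d).prod (X.face α β h).I) (X.face α β h).I ∞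
    (fun p : G × X.face α β h => actFace h p.1 p.2)
  incl_act : ∀ {α β : A} (h : α < β) (g : G) (p : X.face α β h),
    X.incl h (actFace h g p) = act α g (X.incl h p)
  fib_act : ∀ {α β : A} (h : α < β) (g : G) (p : X.face α β h),
    X.fib h (actFace h g p) = act β g (X.fib h p)

/-- An iterated space `X_*` with a smooth action of `G` that has a fixed isotropy group on each
`X_α`, together with its quotient, the iterated space `Y_*` with `Y_α = X_α / G`. -/
structure ResolvedAction where
  X : IteratedSpace.{u} A
  action : SmoothAction d G X
  isotropy : A → Subgroup G
  fixed_isotropy : ∀ α (x : X.space α) (g : G), action.act α g x = x ↔ g ∈ isotropy α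
  Y : IteratedSpace.{u} A
  proj : ∀ α, SmoothMap (X.space α) (Y.space α)
  projFace : ∀ {α β : A} (h : α < β), SmoothMap (X.face α β h) (Y.face α β h)
  isFibration : ∀ α, IsFibration (proj α)
  isFibrationFace : ∀ {α β : A} (h : α < β), IsFibration (projFace h)
  proj_eq_iff : ∀ α (x x' : X.space α), proj α x = proj α x' ↔ ∃ g, action.act α g x = x'
  projFace_eq_iff : ∀ {α β : A} (h : α < β) (p p' : X.face α β h),
    projFace h p = projFace h p' ↔ ∃ g, action.actFace h g p = p'
  incl_proj : ∀ {α β : A} (h : α < β) (p : X.face α β h),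
    Y.incl h (projFace h p) = proj α (X.incl h p)
  fib_proj : ∀ {α β : A} (h : α < β) (p : X.face α β h),
    Y.fib h (projFace h p) = proj β (X.fib h p)

variable {A d G}

/-- An iterated connection. A character `χ` of `G / B_α` defines a Hermitian line bundle over `Y_α`,
the quotient of `X_α × ℂ` with `G` acting on `ℂ` through `χ`; its sections are the functions `s`
on `X_α` with `s (g x) = χ(g) s(x)`. A Hermitian connection on it is `s ↦ ds - i θ_χ s` where
`θ_χ = conn α χ` is an invariant real `1`-form taking on the infinitesimal generators of the action
the values of `-i dχ`. The connections are multiplicative in `χ` and compatible with the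
fibrations. The curvature form on `Y_α`, unique as `X_α → Y_α` is a surjective
submersion, is the real `2`-form `F_χ = curv α χ` that lifts to `dθ_χ`; the curvature
of the connection is `-i F_χ`. -/
structure IteratedConnection (R : ResolvedAction.{u} A d G) where
  conn : ∀ α, annihilator (R.isotropy α) → RawForm (R.X.space α) ℝ 1
  smooth : ∀ α χ, IsSmooth (conn α χ)
  multiplicative : ∀ α χ χ', conn α (χ * χ') = conn α χ + conn α χ'
  invariant : ∀ α χ (g : G), pull (fun x => R.action.act α g x) (conn α χ) = conn α χ
  vertical : ∀ α χ (x : R.X.space α) (ξ : TangentSpace (𝓡 d) (1 : G)),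
    Complex.I * ((conn α χ x fun _ =>
      mfderiv (𝓡 d) (R.X.space α).I (fun g : G => R.action.act α g x) 1 ξ : ℝ) : ℂ) =
    mfderiv (𝓡 d) 𝓘(ℝ, ℂ) (fun g : G => (χ.1 g : ℂ)) 1 ξ
  compatible : ∀ {α β : A} (h : α < β) (χ : PontryaginDual G)
    (hα : χ ∈ annihilator (R.isotropy α)) (hβ : χ ∈ annihilator (R.isotropy β)),
    pull (R.X.incl h) (conn α ⟨χ, hα⟩) = pull (R.X.fib h) (conn β ⟨χ, hβ⟩)
  curv : ∀ α, annihilator (R.isotropy α) → TwoForm (R.Y.space α)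
  lift_curv : ∀ α χ, pull (R.proj α) (curv α χ).1 = extD (conn α χ)

variable {R : ResolvedAction.{u} A d G} (C : IteratedConnection R)

/-- The Chern forms on `Y_α` of the characters of `G / B_α`. -/
noncomputable def IteratedConnection.twist (α : A) : Twist G (R.Y.space α) where
  chars := annihilator (R.isotropy α)
  curv := C.curv α
  closed χ := by
    refine pull_injective (R.isFibration α).surjective (R.isFibration α).surjective_mfderiv ?_
    rw [← extD_pull (R.proj α).contMDiff (C.curv α χ).2, C.lift_curv, extD_extD (C.smooth α χ)]
    rfl

/-- The Chern forms of the characters of `G / B_α` restricted to `H_β(Y_α)`. -/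
noncomputable def IteratedConnection.twistFace {α β : A} (h : α < β) : Twist G (R.Y.face α β h) :=
  (C.twist α).pull (R.Y.incl h)

lemma isotropy_le (R : ResolvedAction.{u} A d G) {α β : A} (h : α < β) :
    R.isotropy α ≤ R.isotropy β := by
  obtain ⟨_, ⟨p, rfl⟩, _⟩ := (R.X.meet_iff h h).2 (Or.inl le_rfl)
  intro g hg
  have h1 := (R.fixed_isotropy α (R.X.incl h p) g).2 hg
  rw [← R.action.incl_act] at h1
  have h2 := (R.X.isBoundaryFace h).injective h1
  rw [← R.fixed_isotropy β (R.X.fib h p), ← R.action.fib_act, h2]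

lemma IteratedConnection.twistFace_curv {α β : A} (h : α < β) (χ : (C.twist β).chars) :
    ∃ hχ : χ.1 ∈ (C.twistFace h).chars,
      (C.twistFace h).curv ⟨χ.1, hχ⟩ = pullTwo (R.Y.fib h) ((C.twist β).curv χ) := by
  obtain ⟨χ, hβ⟩ := χ
  have hβ' : χ ∈ annihilator (R.isotropy β) := hβ
  have hχ : χ ∈ annihilator (R.isotropy α) := fun b hb => hβ' b (isotropy_le R h hb)
  refine ⟨hχ, Subtype.ext ?_⟩
  refine pull_injective (R.isFibrationFace h).surjective
    (R.isFibrationFace h).surjective_mfderiv ?_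
  change pull (R.projFace h) (pull (R.Y.incl h) (C.curv α ⟨χ, hχ⟩).1) =
    pull (R.projFace h) (pull (R.Y.fib h) (C.curv β ⟨χ, hβ'⟩).1)
  have e1 : R.Y.incl h ∘ R.projFace h = R.proj α ∘ R.X.incl h := funext (R.incl_proj h)
  have e2 : R.Y.fib h ∘ R.projFace h = R.proj β ∘ R.X.fib h := funext (R.fib_proj h)
  rw [pull_comp (R.projFace h).contMDiff (R.Y.incl h).contMDiff,
    pull_comp (R.projFace h).contMDiff (R.Y.fib h).contMDiff, e1, e2,
    ← pull_comp (R.X.incl h).contMDiff (R.proj α).contMDiff,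
    ← pull_comp (R.X.fib h).contMDiff (R.proj β).contMDiff, C.lift_curv, C.lift_curv,
    ← extD_pull (R.X.incl h).contMDiff (C.smooth _ _),
    ← extD_pull (R.X.fib h).contMDiff (C.smooth _ _), C.compatible h χ hχ hβ']

/-- Restriction of twisted forms on `Y_α` to `H_β(Y_α)`. -/
noncomputable def IteratedConnection.restrict {α β : A} (h : α < β) :
    TwistedForm (C.twist α) →ₗ[ℂ] TwistedForm (C.twistFace h) :=
  twistPull (R.Y.incl h) _ _ fun χ => ⟨χ.2, rfl⟩

/-- The augmented pull-back of twisted forms on `Y_β` to `H_β(Y_α)`: the pull-back under the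
fibration, after which only the smaller group `B_α` counts. -/
noncomputable def IteratedConnection.augmentedPull {α β : A} (h : α < β) :
    TwistedForm (C.twist β) →ₗ[ℂ] TwistedForm (C.twistFace h) :=
  twistPull (R.Y.fib h) _ _ (C.twistFace_curv h)

/-- The delocalized forms `C^∞(Y_*; Λ_dl)` of parity `ε` relative to `P`, over the part of `Y_*`
indexed by `S`: families of twisted forms compatible under the augmented pull-back maps and
vanishing over the indices in `P`. In particular the forms vanish on the boundary
hypersurfaces indexed by `P`. -/
noncomputable def IteratedConnection.forms (S P : Set A) (ε : ZMod 2) :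
    Submodule ℂ ((α : S) → TwistedForm (C.twist α)) where
  carrier := {u | (∀ (α β : S) (h : α.1 < β.1), C.restrict h (u α) = C.augmentedPull h (u β)) ∧
    (∀ α : S, α.1 ∈ P → u α = 0) ∧ ∀ α : S, u α ∈ twistParity (C.twist α) ε}
  add_mem' {u v} hu hv := by
    refine ⟨fun α β h => ?_, fun α hα => ?_, fun α => add_mem (hu.2.2 α) (hv.2.2 α)⟩
    · rw [Pi.add_apply, Pi.add_apply, map_add, map_add, hu.1 α β h, hv.1 α β h]
    · rw [Pi.add_apply, hu.2.1 α hα, hv.2.1 α hα, add_zero]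
  zero_mem' := ⟨fun α β h => by rw [Pi.zero_apply, Pi.zero_apply, map_zero, map_zero],
    fun _ _ => rfl, fun _ => zero_mem _⟩
  smul_mem' c u hu := by
    refine ⟨fun α β h => ?_, fun α hα => ?_, fun α => Submodule.smul_mem _ c (hu.2.2 α)⟩
    · rw [Pi.smul_apply, Pi.smul_apply, map_smul, map_smul, hu.1 α β h]
    · rw [Pi.smul_apply, hu.2.1 α hα, smul_zero]

/-- The deRham differential on families of twisted forms. -/
noncomputable def IteratedConnection.diff (S : Set A) :
    ((α : S) → TwistedForm (C.twist α)) →ₗ[ℂ] ((α : S) → TwistedForm (C.twist α)) :=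
  LinearMap.pi fun α => twistD (C.twist α) ∘ₗ LinearMap.proj α

lemma IteratedConnection.diff_diff (S : Set A) (u : (α : S) → TwistedForm (C.twist α)) :
    C.diff S (C.diff S u) = 0 :=
  funext fun α => twistD_twistD _ (u α)

lemma IteratedConnection.diff_mem {S P : Set A} {ε : ZMod 2}
    {u : (α : S) → TwistedForm (C.twist α)} (hu : u ∈ C.forms S P ε) :
    C.diff S u ∈ C.forms S P (ε + 1) := by
  refine ⟨fun α β h => ?_, fun α hα => ?_, fun α => twistD_mem_parity (hu.2.2 α)⟩
  · have := congrArg (twistD _) (hu.1 α β h)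
    exact (twistPull_twistD _ _ _ _ _).trans (this.trans (twistPull_twistD _ _ _ _ _).symm)
  · change twistD _ (u α) = 0
    rw [hu.2.1 α hα, map_zero]

/-- The delocalized forms annihilated by the differential. -/
noncomputable def IteratedConnection.closedForms (S P : Set A) (ε : ZMod 2) :
    Submodule ℂ ((α : S) → TwistedForm (C.twist α)) :=
  C.forms S P ε ⊓ LinearMap.ker (C.diff S)

/-- The differentials of delocalized forms, in `C.forms S P ε` by `diff_mem`. -/
noncomputable def IteratedConnection.exactForms (S P : Set A) (ε : ZMod 2) :
    Submodule ℂ ((α : S) → TwistedForm (C.twist α)) :=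
  Submodule.map (C.diff S) (C.forms S P (ε + 1))

/-- The delocalized cohomology, even for `ε = 0` and odd for `ε = 1`, relative to `P`, of the part
of `Y_*` indexed by `S`. -/
abbrev IteratedConnection.Cohomology (S P : Set A) (ε : ZMod 2) :
    Type (max u v w) :=
  C.closedForms S P ε ⧸ (C.exactForms S P ε).submoduleOf (C.closedForms S P ε)

variable {P P' S S' : Set A}

/-- The map in cohomology induced by the inclusion of the forms vanishing over `P'`. -/
noncomputable def IteratedConnection.forget (h : P ⊆ P') (S : Set A) (ε : ZMod 2) :
    C.Cohomology S P' ε →ₗ[ℂ] C.Cohomology S P ε :=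
  have hle : ∀ ε, C.forms S P' ε ≤ C.forms S P ε :=
    fun _ _ hu => ⟨hu.1, fun α hα => hu.2.1 α (h hα), hu.2.2⟩
  Submodule.mapQ _ _
    (Submodule.inclusion (inf_le_inf_right (LinearMap.ker (C.diff S)) (hle ε)))
    (fun _ hu => Submodule.map_mono (hle (ε + 1)) hu)

/-- Restriction of families of forms to fewer indices. -/
noncomputable def IteratedConnection.res (h : S' ⊆ S) :
    ((α : S) → TwistedForm (C.twist α)) →ₗ[ℂ] ((α : S') → TwistedForm (C.twist α)) :=
  LinearMap.pi fun α => LinearMap.proj (⟨α.1, h α.2⟩ : S)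

/-- The map in cohomology induced by the restriction of forms to the indices in `S'`. -/
noncomputable def IteratedConnection.resCohomology (h : S' ⊆ S) (P : Set A) (ε : ZMod 2) :
    C.Cohomology S P ε →ₗ[ℂ] C.Cohomology S' P ε :=
  have hle : ∀ ε, ∀ u ∈ C.forms S P ε, C.res h u ∈ C.forms S' P ε :=
    fun _ _ hu => ⟨fun α β hαβ => hu.1 ⟨α.1, h α.2⟩ ⟨β.1, h β.2⟩ hαβ,
      fun α hα => hu.2.1 ⟨α.1, h α.2⟩ hα, fun α => hu.2.2 ⟨α.1, h α.2⟩⟩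
  Submodule.mapQ _ _
    ((C.res h).restrict (p := C.closedForms S P ε) (q := C.closedForms S' P ε) fun u hu =>
      ⟨hle ε u hu.1, funext fun α => congrFun (LinearMap.mem_ker.1 hu.2) ⟨α.1, h α.2⟩⟩)
    (by
      rintro u ⟨w, hw, e⟩
      exact ⟨C.res h w, hle _ w hw, congrArg (C.res h) e⟩)

end Action

end Deloc

/-! The proposition is the long exact sequence of a short exact sequence of complexes. The
hypotheses say that `P` is closed upwards and that every index above `α` lies in `insert α P`. A
family for `P` therefore restricts to zero on `Set.Ici α` exactly when it vanishes at `α`, that is,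
when it is a family for `insert α P`. What needs proof is that restriction to `Set.Ici α` is
surjective; the connecting map and exactness are then a diagram chase, in which parities modulo 2
close the sequence into a hexagon.

Surjectivity is proved by adding indices one at a time, each maximal among the missing ones. At such
an index `α` the forms over all `β > α` are given. Their augmented pull-backs to the hypersurfaces
`H_β(Y_α)` have to be the boundary values of a single twisted form on `Y_α` (`exists_twistedForm`).

There are two difficulties. The first is that the data are classes modulo the relations `u ⊗ g ≃
Ch(χ) ∧ u ⊗ χg`, so representatives on two hypersurfaces need not agree where these meet. Moving
every term to a fixed representative of its coset modulo the characters of `G / B_α` gives a normal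
form. Since `Ch` is multiplicative (`expPoint_add`), normalizing kills all relations for this group,
in particular those coming from the smaller group of characters of `G / B_β`. Hence normal forms on
different hypersurfaces agree at corners (`sumEval_faceForm`).

The second is to extend ordinary forms, given on the hypersurfaces and agreeing at corners, to the
interior (`IteratedSpace.exists_extension`). This is done one hypersurface at a time: the remaining
discrepancy vanishes on the hypersurfaces already treated, and it is extended by local retractions
that preserve all hypersurfaces, patched by a partition of unity. -/

namespace Deloc

universe u v w

/-! ### Smoothness of forms at a point -/

section LocalSmoothness

variable {M N : CornerManifold.{u}} {V : Type} [NormedAddCommGroup V] [NormedSpace ℝ V] {k : ℕ}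

/-- Smoothness of a form at a point. -/
def IsSmoothAt (η : RawForm M V k) (x : M) : Prop :=
  ∀ x₀ : M, x ∈ (extChartAt M.I x₀).source →
    ContDiffWithinAt ℝ ∞ (inChart η x₀) (Set.range M.I) (extChartAt M.I x₀ x)

lemma isSmooth_iff_isSmoothAt {η : RawForm M V k} : IsSmooth η ↔ ∀ x, IsSmoothAt η x := by
  refine ⟨fun h x x₀ hx => h.contDiffWithinAt x₀ ((extChartAt M.I x₀).map_source hx),
    fun h x₀ y hy => ?_⟩
  have := h _ x₀ ((extChartAt M.I x₀).map_target hy)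
  rw [(extChartAt M.I x₀).right_inv hy] at this
  exact this.mono (extChartAt_target_subset_range x₀)

lemma eventually_extChartAt_symm {x x₀ : M} (hx : x ∈ (extChartAt M.I x₀).source) {p : M → Prop}
    (h : ∀ᶠ z in nhds x, p z) :
    ∀ᶠ y in nhdsWithin (extChartAt M.I x₀ x) (Set.range M.I), p ((extChartAt M.I x₀).symm y) := by
  have h1 := (contMDiffWithinAt_extChartAt_symm_range (I := M.I) (n := ∞) x₀
    ((extChartAt M.I x₀).map_source hx)).continuousWithinAt
  refine h1.eventually ?_
  rwa [(extChartAt M.I x₀).left_inv hx]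

lemma IsSmoothAt.congr {η η' : RawForm M V k} {x : M} (h : IsSmoothAt η x)
    (he : ∀ᶠ z in nhds x, η' z = η z) : IsSmoothAt η' x := by
  intro x₀ hx
  refine (h x₀ hx).congr_of_eventuallyEq_of_mem ?_
    (extChartAt_target_subset_range x₀ ((extChartAt M.I x₀).map_source hx))
  filter_upwards [eventually_extChartAt_symm hx he] with y hy
  simp only [inChart, hy]

lemma IsSmoothAt.zero (x : M) : IsSmoothAt (0 : RawForm M V k) x :=
  isSmooth_iff_isSmoothAt.1 IsSmooth.zero x

lemma IsSmoothAt.add {η η' : RawForm M V k} {x : M} (h : IsSmoothAt η x) (h' : IsSmoothAt η' x) :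
    IsSmoothAt (η + η') x := fun x₀ hx => (h x₀ hx).add (h' x₀ hx)

lemma IsSmoothAt.sum {ι : Type*} (s : Finset ι) {η : ι → RawForm M V k} {x : M}
    (h : ∀ i ∈ s, IsSmoothAt (η i) x) : IsSmoothAt (∑ i ∈ s, η i) x := by
  classical
  induction s using Finset.induction_on with
  | empty => exact IsSmoothAt.zero x
  | insert a s ha ih =>
    rw [Finset.sum_insert ha]
    exact (h a (Finset.mem_insert_self a s)).add
      (ih fun i hi => h i (Finset.mem_insert_of_mem hi))

lemma IsSmoothAt.smul {η : RawForm M V k} {x : M} (h : IsSmoothAt η x) {f : M → ℝ}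
    (hf : ContMDiffAt M.I 𝓘(ℝ) ∞ f x) : IsSmoothAt (fun z => f z • η z) x := by
  intro x₀ hx
  have h1 := contMDiffWithinAt_extChartAt_symm_range (I := M.I) (n := ∞) x₀
    ((extChartAt M.I x₀).map_source hx)
  have h2 : ContMDiffWithinAt 𝓘(ℝ, M.E) 𝓘(ℝ) ∞ (f ∘ (extChartAt M.I x₀).symm) (Set.range M.I)
      (extChartAt M.I x₀ x) := by
    refine ContMDiffAt.comp_contMDiffWithinAt _ ?_ h1
    rwa [(extChartAt M.I x₀).left_inv hx]
  exact h2.contDiffWithinAt.smul (h x₀ hx)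

/-- The chain rule at a single point. Only differentiability there is required, because the formula
will be applied to retractions that are smooth on an open set only. -/
lemma inChart_pull_of_mdifferentiableAt {f : M → N} (η : RawForm N V k)
    (x₀ : M) (y₀ : N) {y : M.E} (hy : y ∈ (extChartAt M.I x₀).target)
    (hf : MDifferentiableAt M.I N.I f ((extChartAt M.I x₀).symm y))
    (hy' : f ((extChartAt M.I x₀).symm y) ∈ (extChartAt N.I y₀).source) :
    inChart (pull f η) x₀ y =
      (inChart η y₀ (extChartAt N.I y₀ (f ((extChartAt M.I x₀).symm y)))).compContinuousLinearMap
        (fderivWithin ℝ (fun z => extChartAt N.I y₀ (f ((extChartAt M.I x₀).symm z)))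
          (Set.range M.I) y) := by
  have hU : UniqueMDiffWithinAt 𝓘(ℝ, M.E) (Set.range M.I) y :=
    (M.I.uniqueDiffOn _ (extChartAt_target_subset_range x₀ hy)).uniqueMDiffWithinAt
  have h1 := mdifferentiableWithinAt_extChartAt_symm (I := M.I) hy
  have h3 : MDifferentiableAt N.I 𝓘(ℝ, N.E) (extChartAt N.I y₀) (f ((extChartAt M.I x₀).symm y)) :=
    mdifferentiableAt_extChartAt (by simpa using hy')
  have h23 := (h3.comp _ hf)
  have key : fderivWithin ℝ (fun z => extChartAt N.I y₀ (f ((extChartAt M.I x₀).symm z)))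
      (Set.range M.I) y =
      (mfderiv N.I 𝓘(ℝ, N.E) (extChartAt N.I y₀) (f ((extChartAt M.I x₀).symm y))) ∘L
      ((mfderiv M.I N.I f ((extChartAt M.I x₀).symm y)) ∘L
      (mfderivWithin 𝓘(ℝ, M.E) M.I (extChartAt M.I x₀).symm (Set.range M.I) y)) := by
    rw [← mfderivWithin_eq_fderivWithin]
    have e1 := mfderiv_comp_mfderivWithin y h23 h1 hU
    have e2 := mfderiv_comp _ h3 hf
    rw [e2] at e1
    exact e1
  have hinv := mfderivWithin_extChartAt_symm_comp_mfderiv_extChartAt' (I := N.I) hy'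
  have aux : ∀ (p q : N) (_ : p = q) (a b : Fin k → N.E), a = b → η p a = η q b := by
    rintro p _ rfl a _ rfl; rfl
  rw [key]
  ext v
  refine aux _ _ ((extChartAt N.I y₀).left_inv hy').symm _ _ (funext fun i => ?_)
  exact (congrArg (fun L : N.E →L[ℝ] N.E => L _) hinv).symm

lemma IsSmoothAt.pull {f : M → N} {x : M} (hf : ContMDiffAt M.I N.I ∞ f x) {η : RawForm N V k}
    (hη : IsSmoothAt η (f x)) : IsSmoothAt (pull f η) x := by
  intro x₀ hx
  set y := extChartAt M.I x₀ x with hy_def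
  have hxy : (extChartAt M.I x₀).symm y = x := (extChartAt M.I x₀).left_inv hx
  have hy : y ∈ (extChartAt M.I x₀).target := (extChartAt M.I x₀).map_source hx
  have hyr := extChartAt_target_subset_range x₀ hy
  have h0 : ContMDiffWithinAt 𝓘(ℝ, M.E) M.I ∞ (extChartAt M.I x₀).symm (Set.range M.I) y :=
    contMDiffWithinAt_extChartAt_symm_range x₀ hy
  have hc : ContDiffWithinAt ℝ ∞
      (fun z => extChartAt N.I (f x) (f ((extChartAt M.I x₀).symm z))) (Set.range M.I) y := by
    rw [← contMDiffWithinAt_iff_contDiffWithinAt]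
    have h1 : ContMDiffAt M.I N.I ∞ f ((extChartAt M.I x₀).symm y) := by rwa [hxy]
    have h2 := h1.comp_contMDiffWithinAt y h0
    have h3 : ContMDiffAt N.I 𝓘(ℝ, N.E) ∞ (extChartAt N.I (f x))
        (f ((extChartAt M.I x₀).symm y)) := by
      rw [hxy]; exact contMDiffAt_extChartAt
    exact h3.comp_contMDiffWithinAt y h2
  have hev : Deloc.inChart (Deloc.pull f η) x₀ =ᶠ[nhdsWithin y (Set.range M.I)] fun y =>
      (inChart η (f x) (extChartAt N.I (f x)
        (f ((extChartAt M.I x₀).symm y)))).compContinuousLinearMap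
        (fderivWithin ℝ (fun z => extChartAt N.I (f x) (f ((extChartAt M.I x₀).symm z)))
          (Set.range M.I) y) := by
    -- The chart formula is needed on a neighbourhood. Regularity of finite order at a point spreads
    -- to nearby points, so order 1 is used here.
    have e1 : ∀ᶠ z in nhds x, MDifferentiableAt M.I N.I f z := by
      have h1 : ContMDiffAt M.I N.I 1 f x := hf.of_le (by norm_num)
      filter_upwards [(contMDiffAt_iff_contMDiffAt_nhds (by norm_num)).1 h1] with z hz
      exact hz.mdifferentiableAt (by norm_num)
    have e2 : ∀ᶠ z in nhds x, f z ∈ (extChartAt N.I (f x)).source :=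
      hf.continuousAt.eventually (extChartAt_source_mem_nhds (f x))
    filter_upwards [extChartAt_target_mem_nhdsWithin_of_mem hy,
      eventually_extChartAt_symm hx e1, eventually_extChartAt_symm hx e2] with z h1 h2 h3
    exact inChart_pull_of_mdifferentiableAt η x₀ (f x) h1 h2 h3
  refine ContDiffWithinAt.congr_of_eventuallyEq_of_mem ?_ hev hyr
  have h3 := hc.fderivWithin_right (m := ∞) M.I.uniqueDiffOn (by norm_num) hyr
  have h5 := hη (f x) (mem_extChartAt_source (f x))
  have h4 : ContDiffWithinAt ℝ ∞ (fun z => inChart η (f x) (extChartAt N.I (f x)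
        (f ((extChartAt M.I x₀).symm z)))) (Set.range M.I) y := by
    have h6 : ContDiffWithinAt ℝ ∞ (inChart η (f x)) (Set.range N.I)
        (extChartAt N.I (f x) (f ((extChartAt M.I x₀).symm y))) := by rwa [hxy]
    exact h6.comp y hc (fun z _ => by simp)
  exact contDiffWithinAt_altComp h4 h3

end LocalSmoothness

/-! ### Maps into boundary faces and local retractions onto them -/

section Lifts

/-- The projection of the quadrant to the face `{x_j = 0}`. -/
def quadrantProj {n : ℕ} (j : Fin n) (x : EuclideanQuadrant n) : EuclideanQuadrant n :=
  ⟨WithLp.toLp 2 (Function.update (fun i => x.1 i) j 0), fun i => by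
    by_cases h : i = j
    · subst h; simp
    · simpa [h] using x.2 i⟩

lemma quadrantProj_apply_same {n : ℕ} (j : Fin n) (x : EuclideanQuadrant n) :
    (quadrantProj j x).1 j = 0 := by simp [quadrantProj]

lemma quadrantProj_apply_of_ne {n : ℕ} {j i : Fin n} (h : i ≠ j) (x : EuclideanQuadrant n) :
    (quadrantProj j x).1 i = x.1 i := by simp [quadrantProj, h]

lemma quadrantProj_apply_eq_zero {n : ℕ} (j : Fin n) {i : Fin n} {x : EuclideanQuadrant n}
    (h : x.1 i = 0) : (quadrantProj j x).1 i = 0 := by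
  by_cases hi : i = j
  · subst hi; exact quadrantProj_apply_same i x
  · rw [quadrantProj_apply_of_ne hi, h]

lemma quadrantProj_eq_self {n : ℕ} {j : Fin n} {x : EuclideanQuadrant n}
    (h : x.1 j = 0) : quadrantProj j x = x := by
  refine EuclideanQuadrant.ext _ _ ?_
  ext i
  by_cases hi : i = j
  · subst hi; rw [quadrantProj_apply_same, h]
  · exact quadrantProj_apply_of_ne hi x

variable {M N Z : CornerManifold.{u}}

/-- The model embedding of the quadrant is the inclusion into Euclidean space, so smoothness can be
tested on coordinates. Continuity is not lost, as the quadrant carries the induced topology. -/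
lemma contMDiffAt_quadrant_iff {n : ℕ} {f : Z → EuclideanQuadrant n} {z : Z} :
    ContMDiffAt Z.I (modelWithCornersEuclideanQuadrant n) ∞ f z ↔
      ∀ i, ContMDiffAt Z.I 𝓘(ℝ) ∞ (fun x => (f x).1 i) z := by
  have e : ContMDiffAt Z.I (modelWithCornersEuclideanQuadrant n) ∞ f z ↔
      ContMDiffAt Z.I 𝓘(ℝ, EuclideanSpace ℝ (Fin n)) ∞ (fun x => (f x).1) z := by
    rw [contMDiffAt_iff_target]
    refine ⟨fun h => h.2, fun h => ⟨?_, h⟩⟩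
    exact (Topology.IsInducing.subtypeVal.continuousAt_iff).2 h.continuousAt
  rw [e]
  have e2 : ContMDiffAt Z.I 𝓘(ℝ, EuclideanSpace ℝ (Fin n)) ∞ (fun x => (f x).1) z ↔
      ContMDiffAt Z.I 𝓘(ℝ, Fin n → ℝ) ∞ (fun x i => (f x).1 i) z := by
    constructor
    · exact fun h => ((EuclideanSpace.equiv (Fin n) ℝ).contDiff.contMDiff.contMDiffAt).comp z h
    · exact fun h => ((EuclideanSpace.equiv (Fin n) ℝ).symm.contDiff.contMDiff.contMDiffAt).comp z h
  rw [e2, contMDiffAt_pi_space]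

/-- A map into a boundary face is smooth where its composition with the inclusion is. -/
lemma IsBoundaryFace.contMDiffAt_lift {i : SmoothMap M N} (hi : IsBoundaryFace i) {l : Z → M}
    {z : Z} (h : ContMDiffAt Z.I N.I ∞ (fun x => i (l x)) z) : ContMDiffAt Z.I M.I ∞ l z := by
  -- An injective continuous map from a compact space to a Hausdorff one is an embedding, so the
  -- lift is automatically continuous and stays in one chart of the face.
  have hemb : Topology.IsClosedEmbedding i :=
    i.contMDiff.continuous.isClosedEmbedding hi.injective
  have hc : ContinuousAt l z := (hemb.isInducing.continuousAt_iff).2 h.continuousAt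
  obtain ⟨e, he, e', he', j, σ, hp, hm, hσ, hr, hq⟩ := hi.charts (l z)
  have h1 : ∀ᶠ x in nhds z, l x ∈ e.source := hc.eventually (e.open_source.mem_nhds hp)
  have h2 : ContMDiffAt Z.I N.I ∞ (fun x => e' (i (l x))) z :=
    (contMDiffAt_of_mem_maximalAtlas he' (hm hp)).comp z h
  have h3 : ContMDiffAt Z.I M.I ∞ (fun x => e (l x)) z := by
    rw [contMDiffAt_quadrant_iff] at h2 ⊢
    intro m
    refine (h2 (σ m)).congr_of_eventuallyEq ?_
    filter_upwards [h1] with x hx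
    exact ((hq _ hx).2 m).symm
  have h4 : ContMDiffAt Z.I M.I ∞ (fun x => e.symm (e (l x))) z :=
    (contMDiffAt_symm_of_mem_maximalAtlas he (e.map_source hp)).comp z h3
  refine h4.congr_of_eventuallyEq ?_
  filter_upwards [h1] with x hx
  exact (e.left_inv hx).symm

lemma contMDiffAt_quadrantProj (j : Fin Z.dim) {f : Z → EuclideanQuadrant Z.dim} {z : Z}
    (h : ContMDiffAt Z.I Z.I ∞ f z) : ContMDiffAt Z.I Z.I ∞ (fun x => quadrantProj j (f x)) z := by
  rw [contMDiffAt_quadrant_iff] at h ⊢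
  intro i
  by_cases hi : i = j
  · subst hi
    simp only [quadrantProj_apply_same]
    exact contMDiffAt_const
  · simp only [quadrantProj_apply_of_ne hi]
    exact h i

lemma continuous_quadrantProj {n : ℕ} (j : Fin n) : Continuous (quadrantProj j) := by
  refine Topology.IsInducing.subtypeVal.continuous_iff.2 ?_
  refine (PiLp.continuous_toLp 2 _).comp ?_
  refine Continuous.update ?_ _ continuous_const
  exact (PiLp.continuous_ofLp 2 _).comp continuous_subtype_val

variable {A : Type w} [PartialOrder A] (X : IteratedSpace.{u} A)

/-- Near each of its points a collective boundary hypersurface is a smooth retract, by a retraction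
preserving all collective boundary hypersurfaces. -/
lemma IteratedSpace.exists_retraction {α β : A} (h : α < β) (p : X.face α β h) :
    ∃ (U : Set (X.space α)) (r : X.space α → X.face α β h), IsOpen U ∧ X.incl h p ∈ U ∧
      (∀ q ∈ U, ContMDiffAt (X.space α).I (X.face α β h).I ∞ r q) ∧
      (∀ x, X.incl h x ∈ U → r (X.incl h x) = x) ∧
      ∀ β' (h' : α < β'), ∀ q ∈ U, q ∈ Set.range (X.incl h') →
        X.incl h (r q) ∈ Set.range (X.incl h') := by
  classical
  obtain ⟨e, he, c, hp, hc1, -, -, hc4⟩ := X.boundary α (X.incl h p)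
  obtain ⟨j, hj, hj'⟩ := hc1 β h ⟨p, rfl⟩
  have hface : ∀ q ∈ e.source, (e q).1 j = 0 → q ∈ Set.range (X.incl h) := fun q hq h0 =>
    ((hc4 q hq).1 β h).2 ⟨j, hj, h0⟩
  have hzero : ∀ x, X.incl h x ∈ e.source → (e (X.incl h x)).1 j = 0 := by
    intro x hx
    obtain ⟨j1, hj1, h0⟩ := ((hc4 _ hx).1 β h).1 ⟨x, rfl⟩
    rwa [← hj' j1 hj1]
  set U : Set (X.space α) := e.source ∩ e ⁻¹' (quadrantProj j ⁻¹' e.target) with hU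
  have hUo : IsOpen U :=
    e.isOpen_inter_preimage (e.open_target.preimage (continuous_quadrantProj j))
  have hpU : X.incl h p ∈ U := ⟨hp, by
    change quadrantProj j (e (X.incl h p)) ∈ e.target
    rw [quadrantProj_eq_self (hzero p hp)]
    exact e.map_source hp⟩
  -- In a chart adapted to the boundary the retraction sets the defining coordinate `x_j` of `H_β`
  -- to zero; `U` is where the result is still in the range of the chart.
  let g : X.space α → X.space α := fun q => e.symm (quadrantProj j (e q))
  have hgs : ∀ q ∈ U, g q ∈ e.source := fun q hq => e.map_target hq.2
  have heg : ∀ q ∈ U, e (g q) = quadrantProj j (e q) := fun q hq => e.right_inv hq.2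
  have hg : ∀ q ∈ U, ∃ x, X.incl h x = g q := by
    intro q hq
    refine hface _ (hgs q hq) ?_
    rw [heg q hq, quadrantProj_apply_same]
  -- The lift of `g` to the face; the value `p` off `U` is irrelevant.
  let r : X.space α → X.face α β h := fun q =>
    if hq : ∃ x, X.incl h x = g q then hq.choose else p
  have hr : ∀ q ∈ U, X.incl h (r q) = g q := by
    intro q hq
    simp only [r, dif_pos (hg q hq)]
    exact (hg q hq).choose_spec
  refine ⟨U, r, hUo, hpU, fun q hq => ?_, fun x hx => ?_, fun β' h' q hq hqr => ?_⟩
  · refine (X.isBoundaryFace h).contMDiffAt_lift ?_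
    have h1 : ContMDiffAt (X.space α).I (X.space α).I ∞ g q :=
      (contMDiffAt_symm_of_mem_maximalAtlas he hq.2).comp q
        (contMDiffAt_quadrantProj j (contMDiffAt_of_mem_maximalAtlas he hq.1))
    refine h1.congr_of_eventuallyEq ?_
    filter_upwards [hUo.mem_nhds hq] with x hx
    exact hr x hx
  · refine (X.isBoundaryFace h).injective ?_
    rw [hr _ hx]
    change e.symm (quadrantProj j (e (X.incl h x))) = _
    rw [quadrantProj_eq_self (hzero x hx.1), e.left_inv hx.1]
  · rw [hr q hq]
    -- Setting `x_j` to zero does not disturb the vanishing of another coordinate, so points of any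
    -- other hypersurface remain in it.
    obtain ⟨j1, hj1, h0⟩ := ((hc4 q hq.1).1 β' h').1 hqr
    refine ((hc4 _ (hgs q hq)).1 β' h').2 ⟨j1, hj1, ?_⟩
    rw [heg q hq]
    exact quadrantProj_apply_eq_zero j h0

end Lifts

/-! ### Patching forms by partitions of unity -/

section Gluing

variable {M N : CornerManifold.{u}} {V : Type} [NormedAddCommGroup V] [NormedSpace ℝ V] {k : ℕ}

/-- Smooth forms satisfying a pointwise convex condition can be patched together. -/
lemma exists_isSmooth_of_local (C : (x : M) → Set (M.E [⋀^Fin k]→L[ℝ] V))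
    (hC : ∀ x, Convex ℝ (C x))
    (hloc : ∀ x : M, ∃ (U : Set M) (η : RawForm M V k), IsOpen U ∧ x ∈ U ∧
      ∀ q ∈ U, IsSmoothAt η q ∧ η q ∈ C q) :
    ∃ η : RawForm M V k, IsSmooth η ∧ ∀ q, η q ∈ C q := by
  choose U η hUo hxU hη using hloc
  obtain ⟨t, ht⟩ := CompactSpace.elim_nhds_subcover U fun x => (hUo x).mem_nhds (hxU x)
  obtain ⟨ρ, hρ⟩ := SmoothPartitionOfUnity.exists_isSubordinate M.I (s := (Set.univ : Set M))
    isClosed_univ (fun i : t => U i) (fun i => hUo i) (by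
      intro x _
      have hx : x ∈ ⋃ y ∈ t, U y := by rw [ht]; trivial
      obtain ⟨y, hy, hxy⟩ := Set.mem_iUnion₂.1 hx
      exact Set.mem_iUnion.2 ⟨⟨y, hy⟩, hxy⟩)
  refine ⟨∑ i : t, fun x => ρ i x • η i x, isSmooth_iff_isSmoothAt.2 fun x => ?_, fun q => ?_⟩
  · refine IsSmoothAt.sum _ fun i _ => ?_
    by_cases hx : x ∈ tsupport (ρ i)
    · exact (hη i x (hρ i hx)).1.smul (ρ i).contMDiff.contMDiffAt
    -- Off the support of `ρ i` the product is zero near `x`, whatever `η i` does there.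
    · refine (IsSmoothAt.zero x).congr ?_
      filter_upwards [(isClosed_tsupport (ρ i)).isOpen_compl.mem_nhds hx] with z hz
      rw [image_eq_zero_of_notMem_tsupport hz, zero_smul]
      rfl
  · rw [Finset.sum_apply]
    have h1 : ∑ i : t, ρ i q = 1 := by
      rw [← finsum_eq_sum_of_fintype]
      exact ρ.sum_eq_one (Set.mem_univ q)
    have h2 := (hC q).finsum_mem (w := fun i : t => ρ i q) (z := fun i : t => η i q)
      (fun i => ρ.nonneg i q) (by rw [finsum_eq_sum_of_fintype, h1])
      (fun i hi => (hη i q (hρ i (subset_tsupport _ hi))).2)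
    rwa [finsum_eq_sum_of_fintype] at h2

/-- The derivative of a map between manifolds, as a map of the model spaces. -/
noncomputable def tangent (f : M → N) (x : M) : M.E →L[ℝ] N.E := mfderiv M.I N.I f x

/-- The value of a form at a point, on vectors of the model space. -/
def formAt (η : RawForm M V k) (x : M) : M.E [⋀^Fin k]→L[ℝ] V := η x

lemma formAt_pull_apply (f : M → N) (η : RawForm N V k) (x : M) (v : Fin k → M.E) :
    formAt (pull f η) x v = formAt η (f x) (fun m => tangent f x (v m)) := rfl

lemma tangent_comp {K : CornerManifold.{u}} {g : N → K} {f : M → N} {x : M}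
    (hg : ContMDiffAt N.I K.I ∞ g (f x)) (hf : ContMDiffAt M.I N.I ∞ f x) (v : M.E) :
    tangent (fun z => g (f z)) x v = tangent g (f x) (tangent f x v) :=
  congrArg (fun L : M.E →L[ℝ] K.E => L v)
    (mfderiv_comp x (hg.mdifferentiableAt (by norm_num)) (hf.mdifferentiableAt (by norm_num)))

lemma tangent_congr {f g : M → N} {x : M} (h : f =ᶠ[nhds x] g) : tangent f x = tangent g x :=
  h.mfderiv_eq (I := M.I) (I' := N.I)

lemma tangent_of_eventually_eq_self {f : M → M} {x : M} (h : ∀ᶠ z in nhds x, f z = z) (v : M.E) :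
    tangent f x v = v := by
  have h1 : f =ᶠ[nhds x] id := h
  rw [tangent_congr h1]
  exact congrArg (fun L : M.E →L[ℝ] M.E => L v) (mfderiv_id (I := M.I) (x := x))

end Gluing

/-! ### Extension of forms from the boundary hypersurfaces -/

section Faces

variable {A : Type w} [PartialOrder A] (X : IteratedSpace.{u} A) {α : A}
  {V : Type} [NormedAddCommGroup V] [NormedSpace ℝ V] {k : ℕ}

lemma IteratedSpace.continuous_incl {β : A} (h : α < β) : Continuous (X.incl h) :=
  (X.incl h).contMDiff.continuous

lemma IteratedSpace.contMDiffAt_incl {β : A} (h : α < β) (p : X.face α β h) :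
    ContMDiffAt (X.face α β h).I (X.space α).I ∞ (X.incl h) p :=
  (X.incl h).contMDiff.contMDiffAt

lemma IteratedSpace.isClosed_range_incl {β : A} (h : α < β) : IsClosed (Set.range (X.incl h)) :=
  (isCompact_range (X.continuous_incl h)).isClosed

/-- By the chain rule, the derivative of a local retraction is a left inverse. -/
lemma IteratedSpace.tangent_incl_injective {β : A} (h : α < β) (p : X.face α β h) :
    Function.Injective (tangent (X.incl h) p) := by
  obtain ⟨U, r, hU, hpU, hr, hri, -⟩ := X.exists_retraction h p
  have h1 : ∀ v, tangent r (X.incl h p) (tangent (X.incl h) p v) = v := by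
    intro v
    rw [← tangent_comp (hr _ hpU) (X.contMDiffAt_incl h p)]
    refine tangent_of_eventually_eq_self ?_ v
    filter_upwards [(X.continuous_incl h).continuousAt.preimage_mem_nhds (hU.mem_nhds hpU)]
      with z hz using hri z hz
  exact Function.LeftInverse.injective h1

/-- A smooth map into `X_α` with values in a collective boundary hypersurface lifts to it. -/
lemma IteratedSpace.exists_lift {β : A} (h : α < β) {Z : CornerManifold.{u}}
    {f : Z → X.space α} {z : Z} (hf : ContMDiffAt Z.I (X.space α).I ∞ f z)
    (hr : ∀ᶠ x in nhds z, f x ∈ Set.range (X.incl h)) :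
    ∃ l : Z → X.face α β h, ContMDiffAt Z.I (X.face α β h).I ∞ l z ∧
      ∀ᶠ x in nhds z, X.incl h (l x) = f x := by
  classical
  obtain ⟨p, -⟩ := hr.self_of_nhds
  let l : Z → X.face α β h := fun x => if hx : ∃ y, X.incl h y = f x then hx.choose else p
  have hl : ∀ᶠ x in nhds z, X.incl h (l x) = f x := by
    filter_upwards [hr] with x hx
    have hx' : ∃ y, X.incl h y = f x := hx
    simp only [l, dif_pos hx']
    exact hx'.choose_spec
  exact ⟨l, (X.isBoundaryFace h).contMDiffAt_lift (hf.congr_of_eventuallyEq hl), hl⟩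

/-- A form on a collective boundary hypersurface that vanishes at the intersections with others
has an extension that vanishes on the others. -/
lemma IteratedSpace.exists_extension_vanishing {β : A} (h : α < β)
    {μ : RawForm (X.face α β h) V k} (hμ : IsSmooth μ) (T : Finset A)
    (hT : ∀ β' ∈ T, ∀ (h' : α < β') (p : X.face α β h) (s : X.face α β' h'),
      X.incl h p = X.incl h' s → ∀ (a : Fin k → (X.face α β h).E) (b : Fin k → (X.face α β' h').E),
      (∀ m, tangent (X.incl h) p (a m) = tangent (X.incl h') s (b m)) → formAt μ p a = 0) :
    ∃ η : RawForm (X.space α) V k, IsSmooth η ∧ pull (X.incl h) η = μ ∧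
      ∀ β' ∈ T, ∀ h' : α < β', pull (X.incl h') η = 0 := by
  -- All requirements on the extension are affine conditions on its value at each point: the
  -- pull-back to `H_β` is `μ` and the pull-backs to the `H_β'` are zero. They survive convex
  -- combinations, so the problem is local.
  let C : (x : X.space α) → Set ((X.space α).E [⋀^Fin k]→L[ℝ] V) := fun x =>
    {b | (∀ p, X.incl h p = x →
      ∀ a : Fin k → (X.face α β h).E, b (fun m => tangent (X.incl h) p (a m)) = formAt μ p a) ∧
      ∀ β' ∈ T, ∀ (h' : α < β') (s : X.face α β' h'), X.incl h' s = x →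
        ∀ a : Fin k → (X.face α β' h').E, b (fun m => tangent (X.incl h') s (a m)) = 0}
  have hC : ∀ x, Convex ℝ (C x) := by
    intro x b hb b' hb' c c' _ _ hcc
    refine ⟨fun p hp a => ?_, fun β' hβ' h' s hs a => ?_⟩
    · rw [ContinuousAlternatingMap.add_apply, ContinuousAlternatingMap.smul_apply,
        ContinuousAlternatingMap.smul_apply, hb.1 p hp, hb'.1 p hp, ← add_smul, hcc, one_smul]
    · rw [ContinuousAlternatingMap.add_apply, ContinuousAlternatingMap.smul_apply,
        ContinuousAlternatingMap.smul_apply, hb.2 β' hβ' h' s hs, hb'.2 β' hβ' h' s hs, smul_zero,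
        smul_zero, add_zero]
  obtain ⟨η, hη, hηC⟩ := exists_isSmooth_of_local C hC fun x => by
    by_cases hx : x ∈ Set.range (X.incl h)
    · obtain ⟨p, rfl⟩ := hx
      obtain ⟨U, r, hU, hpU, hr, hri, hrp⟩ := X.exists_retraction h p
      refine ⟨U, pull r μ, hU, hpU, fun q hq =>
        ⟨(isSmooth_iff_isSmoothAt.1 hμ _).pull (hr q hq), ?_, ?_⟩⟩
      · rintro p' rfl a
        change formAt μ (r (X.incl h p')) (fun m => tangent r _ (tangent (X.incl h) p' (a m))) = _
        have e : ∀ m, tangent r (X.incl h p') (tangent (X.incl h) p' (a m)) = a m := by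
          intro m
          rw [← tangent_comp (hr _ hq) (X.contMDiffAt_incl h p')]
          refine tangent_of_eventually_eq_self ?_ _
          filter_upwards [(X.continuous_incl h).continuousAt.preimage_mem_nhds (hU.mem_nhds hq)]
            with z hz using hri z hz
        simp only [e, hri p' hq]
      · rintro β' hβ' h' s rfl a
        -- The retraction maps `H_β'` into `H_β ∩ H_β'`. Lifting this map to `H_β'` as well shows
        -- that the images of vectors tangent to `H_β'` are tangent to both hypersurfaces, and there
        -- `μ` vanishes by hypothesis.
        have hrs : ContMDiffAt (X.face α β' h').I (X.face α β h).I ∞ (fun z => r (X.incl h' z)) s :=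
          (hr _ hq).comp s (X.contMDiffAt_incl h' s)
        have hirs : ContMDiffAt (X.face α β' h').I (X.space α).I ∞
            (fun z => X.incl h (r (X.incl h' z))) s :=
          (X.contMDiffAt_incl h _).comp s hrs
        obtain ⟨l, hl, hl'⟩ := X.exists_lift h' hirs (by
          filter_upwards [(X.continuous_incl h').continuousAt.preimage_mem_nhds (hU.mem_nhds hq)]
            with z hz using hrp β' h' _ hz ⟨z, rfl⟩)
        refine hT β' hβ' h' _ (l s) hl'.self_of_nhds.symm
          (fun m => tangent r (X.incl h' s) (tangent (X.incl h') s (a m)))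
          (fun m => tangent l s (a m)) fun m => ?_
        rw [← tangent_comp (hr _ hq) (X.contMDiffAt_incl h' s),
          ← tangent_comp (X.contMDiffAt_incl h _) hrs,
          ← tangent_comp (X.contMDiffAt_incl h' _) hl, tangent_congr hl']
    -- Away from `H_β` the zero form meets all conditions.
    · refine ⟨(Set.range (X.incl h))ᶜ, 0, (X.isClosed_range_incl h).isOpen_compl, hx,
        fun q hq => ⟨IsSmoothAt.zero q, ?_, fun _ _ _ _ _ _ => rfl⟩⟩
      rintro p rfl
      exact absurd ⟨p, rfl⟩ hq
  refine ⟨η, hη, ?_, fun β' hβ' h' => ?_⟩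
  · funext p
    ext a
    exact (hηC (X.incl h p)).1 p rfl a
  · funext p
    ext a
    exact (hηC (X.incl h' p)).2 β' hβ' h' p rfl a

/-- Forms on the collective boundary hypersurfaces which agree at their intersections extend. -/
lemma IteratedSpace.exists_extension [Finite A] (μ : ∀ β (h : α < β), RawForm (X.face α β h) V k)
    (hμ : ∀ β h, IsSmooth (μ β h))
    (hc : ∀ (β β' : A) (h : α < β) (h' : α < β') (p : X.face α β h) (s : X.face α β' h'),
      X.incl h p = X.incl h' s → ∀ (a : Fin k → (X.face α β h).E) (b : Fin k → (X.face α β' h').E),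
      (∀ m, tangent (X.incl h) p (a m) = tangent (X.incl h') s (b m)) → formAt (μ β h) p a = formAt (μ β' h') s b) :
    ∃ η : RawForm (X.space α) V k, IsSmooth η ∧ ∀ β (h : α < β), pull (X.incl h) η = μ β h := by
  classical
  cases nonempty_fintype A
  suffices H : ∀ T : Finset A, ∃ η : RawForm (X.space α) V k, IsSmooth η ∧
      ∀ β ∈ T, ∀ h : α < β, pull (X.incl h) η = μ β h by
    obtain ⟨η, hη, h⟩ := H Finset.univ
    exact ⟨η, hη, fun β => h β (Finset.mem_univ β)⟩
  intro T
  induction T using Finset.induction_on with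
  | empty => exact ⟨0, IsSmooth.zero, by simp⟩
  | insert β T _ ih =>
    obtain ⟨η, hη, hT⟩ := ih
    by_cases h : α < β
    swap
    · refine ⟨η, hη, fun β' hβ' h' => ?_⟩
      rcases Finset.mem_insert.1 hβ' with rfl | hβ'
      exacts [absurd h' h, hT β' hβ' h']
    have hneg : IsSmooth (fun p => (-1 : ℝ) • pull (X.incl h) η p) :=
      isSmooth_iff_isSmoothAt.2 fun p => (isSmooth_iff_isSmoothAt.1
        (hη.pull (X.incl h).contMDiff) p).smul contMDiffAt_const
    -- The discrepancy between `μ` and `η` on `H_β` vanishes at the intersections with the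
    -- hypersurfaces already treated, because `η` is right there. A correction `ξ` can thus be found
    -- that changes nothing on them.
    obtain ⟨ξ, hξ, h1, h2⟩ := X.exists_extension_vanishing h ((hμ β h).add hneg) T (by
      intro β' hβ' h' p s hps a b hab
      have e1 := hc β β' h h' p s hps a b hab
      rw [← hT β' hβ' h', formAt_pull_apply, ← hps, ← funext hab] at e1
      change formAt (μ β h) p a + (-1 : ℝ) • formAt η (X.incl h p)
        (fun m => tangent (X.incl h) p (a m)) = 0
      rw [e1, neg_one_smul, add_neg_cancel])
    refine ⟨η + ξ, hη.add hξ, fun β' hβ' h' => ?_⟩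
    have hadd : pull (X.incl h') (η + ξ) = pull (X.incl h') η + pull (X.incl h') ξ := rfl
    rw [hadd]
    rcases Finset.mem_insert.1 hβ' with rfl | hβ'
    · rw [h1]
      funext p
      change pull (X.incl h) η p + (μ β' h p + (-1 : ℝ) • pull (X.incl h) η p) = μ β' h p
      rw [neg_one_smul]
      abel
    · rw [h2 β' hβ', add_zero, hT β' hβ' h']

/-- At a point of the intersection of two collective boundary hypersurfaces `H_β` and `H_γ`, the
maps from `H_β` to `H_β` and to `H_γ` induced by a retraction to the intersection, and the lift to
`H_γ(X_β)` of the fibration to `X_β`, on the level of tangent vectors. -/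
lemma IteratedSpace.exists_corner_tangent {β γ : A} (h : α < β) (h' : β < γ) (p : X.face α β h)
    (s : X.face α γ (h.trans h')) (hps : X.incl h p = X.incl (h.trans h') s) :
    ∃ (q : X.face β γ h') (Dl : (X.face α β h).E →L[ℝ] (X.face α β h).E)
      (Df : (X.face α β h).E →L[ℝ] (X.face α γ (h.trans h')).E)
      (Dm : (X.face α β h).E →L[ℝ] (X.face β γ h').E),
      X.incl h' q = X.fib h p ∧ X.fib h' q = X.fib (h.trans h') s ∧
      tangent (X.incl h) p ∘L Dl = tangent (X.incl (h.trans h')) s ∘L Df ∧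
      tangent (X.incl h') q ∘L Dm = tangent (X.fib h) p ∘L Dl ∧
      tangent (X.fib h') q ∘L Dm = tangent (X.fib (h.trans h')) s ∘L Df ∧
      ∀ a b, tangent (X.incl h) p a = tangent (X.incl (h.trans h')) s b → Dl a = a ∧ Df a = b := by
  have hγ := h.trans h'
  obtain ⟨U, r, hU, hsU, hr, hri, hrp⟩ := X.exists_retraction hγ s
  have hpU : X.incl h p ∈ U := by rw [hps]; exact hsU
  have hpU' : ∀ᶠ z in nhds p, X.incl h z ∈ U :=
    (X.continuous_incl h).continuousAt.preimage_mem_nhds (hU.mem_nhds hpU)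
  -- The corner is not given as a manifold, so it is replaced by a retraction onto it, seen in three
  -- places: `f` takes values in `H_γ`, `l` is the same point regarded in `H_β`, and `m` is its
  -- image under the fibration, regarded in `H_γ(X_β)`. All relations between the derivatives come
  -- from identities between these maps near `p`.
  set f : X.face α β h → X.face α γ hγ := fun z => r (X.incl h z) with hf_def
  have hf : ContMDiffAt (X.face α β h).I (X.face α γ hγ).I ∞ f p :=
    (hr _ hpU).comp p (X.contMDiffAt_incl h p)
  have hfp : f p = s := by
    change r (X.incl h p) = s
    rw [hps, hri s hsU]
  have hif : ContMDiffAt (X.face α β h).I (X.space α).I ∞ (fun z => X.incl hγ (f z)) p :=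
    (X.contMDiffAt_incl hγ _).comp p hf
  obtain ⟨l, hl, hl'⟩ := X.exists_lift h hif (by
    filter_upwards [hpU'] with z hz using hrp β h _ hz ⟨z, rfl⟩)
  have hlp : l p = p := by
    refine (X.isBoundaryFace h).injective ?_
    rw [hl'.self_of_nhds, hfp, hps]
  have hfl : ContMDiffAt (X.face α β h).I (X.space β).I ∞ (fun z => X.fib h (l z)) p :=
    ((X.fib h).contMDiff.contMDiffAt (x := l p)).comp p hl
  obtain ⟨m, hm, hm'⟩ := X.exists_lift h' hfl (by
    filter_upwards [hl'] with z hz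
    -- The fibration takes the corner into `H_γ(X_β)`, which is what allows the lift `m`.
    rw [← X.image_face h h']
    exact ⟨l z, ⟨f z, hz.symm⟩, rfl⟩)
  have hmf : ∀ᶠ z in nhds p, X.fib h' (m z) = X.fib hγ (f z) := by
    filter_upwards [hl', hm'] with z hz hz'
    exact X.fib_fib h h' (l z) (f z) (m z) hz hz'
  refine ⟨m p, tangent l p, tangent f p, tangent m p, ?_, ?_, ?_, ?_, ?_, fun a b hab => ?_⟩
  · rw [hm'.self_of_nhds, hlp]
  · rw [hmf.self_of_nhds, hfp]
  · ext1 v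
    have e := congrArg (fun L => L v) (tangent_congr hl')
    simp only [tangent_comp (X.contMDiffAt_incl h _) hl,
      tangent_comp (X.contMDiffAt_incl hγ _) hf, hlp, hfp] at e
    exact e
  · ext1 v
    have e := congrArg (fun L => L v) (tangent_congr hm')
    simp only [tangent_comp (X.contMDiffAt_incl h' _) hm,
      tangent_comp ((X.fib h).contMDiff.contMDiffAt (x := l p)) hl, hlp] at e
    exact e
  · ext1 v
    have e := congrArg (fun L => L v) (tangent_congr hmf)
    simp only [tangent_comp ((X.fib h').contMDiff.contMDiffAt (x := m p)) hm,
      tangent_comp ((X.fib hγ).contMDiff.contMDiffAt (x := f p)) hf, hfp] at e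
    exact e
  -- The retraction is the identity along `H_γ`, so a vector tangent to both hypersurfaces is fixed.
  -- For `Dl` this follows after applying the injective derivative of the inclusion.
  · have hDf : tangent f p a = b := by
      rw [hf_def, tangent_comp (hr _ hpU) (X.contMDiffAt_incl h p), hab, hps,
        ← tangent_comp (hr _ hsU) (X.contMDiffAt_incl hγ s)]
      refine tangent_of_eventually_eq_self ?_ _
      filter_upwards [(X.continuous_incl hγ).continuousAt.preimage_mem_nhds (hU.mem_nhds hsU)]
        with z hz using hri z hz
    refine ⟨X.tangent_incl_injective h p ?_, hDf⟩
    have e := congrArg (fun L => L a) (tangent_congr hl')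
    simp only [tangent_comp (X.contMDiffAt_incl h _) hl,
      tangent_comp (X.contMDiffAt_incl hγ _) hf, hlp, hfp] at e
    rw [e, hDf, hab]

end Faces

/-! ### Multiplicativity of the exponential of a 2-form -/

section PointwiseWedge

set_option maxSynthPendingDepth 3

variable {E F V : Type*} [NormedAddCommGroup E] [NormedSpace ℝ E]
  [NormedAddCommGroup F] [NormedSpace ℝ F] [NormedAddCommGroup V] [NormedSpace ℝ V] {k : ℕ}

open ContinuousAlternatingMap (alternatizeUncurryFin alternatizeUncurryFinCLM)

/-- The wedge product with a `1`-form. -/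
noncomputable def oneWedge (φ : E →L[ℝ] ℝ) : (E [⋀^Fin k]→L[ℝ] V) →ₗ[ℝ] E [⋀^Fin (k + 1)]→L[ℝ] V where
  toFun w := alternatizeUncurryFinCLM ℝ E V (φ.smulRight w)
  map_add' w w' := by rw [← map_add]; congr 1; ext1 x; exact smul_add (φ x) w w'
  map_smul' c w := by
    rw [RingHom.id_apply, ← map_smul]; congr 1; ext1 x; exact smul_comm (φ x) c w

/-- Exchanging the two arguments before a double alternation changes the sign (`alt_flip`). -/
lemma oneWedge_anticomm (φ ψ : E →L[ℝ] ℝ) (w : E [⋀^Fin k]→L[ℝ] V) :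
    oneWedge φ (oneWedge ψ w) = - oneWedge ψ (oneWedge φ w) := by
  let f : E →L[ℝ] E →L[ℝ] E [⋀^Fin k]→L[ℝ] V := ψ.smulRight (φ.smulRight w)
  have h := alt_flip f
  have e1 : alternatizeUncurryFinCLM ℝ E V ∘L f = ψ.smulRight (oneWedge φ w) := by
    ext1 x
    exact map_smul (alternatizeUncurryFinCLM ℝ E V) (ψ x) (φ.smulRight w)
  have e2 : alternatizeUncurryFinCLM ℝ E V ∘L f.flip = φ.smulRight (oneWedge ψ w) := by
    ext1 x
    refine Eq.trans (congrArg (alternatizeUncurryFinCLM ℝ E V) ?_)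
      (map_smul (alternatizeUncurryFinCLM ℝ E V) (φ x) (ψ.smulRight w))
    ext1 y
    exact smul_comm (ψ y) (φ x) w
  rw [e1, e2] at h
  exact h

/-- Moving one pair past the other takes four transpositions, so the signs cancel. -/
lemma oneWedge_four (φ ψ φ' ψ' : E →L[ℝ] ℝ) (w : E [⋀^Fin k]→L[ℝ] V) :
    oneWedge φ (oneWedge ψ (oneWedge φ' (oneWedge ψ' w))) =
      oneWedge φ' (oneWedge ψ' (oneWedge φ (oneWedge ψ w))) := by
  rw [oneWedge_anticomm ψ φ', map_neg, oneWedge_anticomm φ φ', neg_neg,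
    oneWedge_anticomm ψ ψ', map_neg, map_neg, oneWedge_anticomm φ ψ', map_neg, neg_neg]

/-- Expanding the first argument of `a` in a basis reduces wedge products with 2-forms to products
with pairs of 1-forms; commutativity is then a matter of signs. -/
lemma twoWedge_eq_sum [FiniteDimensional ℝ E] (a : E [⋀^Fin 2]→L[ℝ] ℝ) (w : E [⋀^Fin k]→L[ℝ] V) :
    twoWedge a w = (1 / 2 : ℝ) • ∑ i, oneWedge ((Module.finBasis ℝ E).coord i).toContinuousLinearMap
      (oneWedge (bilin a (Module.finBasis ℝ E i)) w) := by
  set e := Module.finBasis ℝ E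
  rw [twoWedge]
  congr 1
  have h : alternatizeUncurryFinCLM ℝ E V ∘L bilinSMul (bilin a) w =
      ∑ i, ((e.coord i).toContinuousLinearMap).smulRight (oneWedge (bilin a (e i)) w) := by
    ext1 x
    rw [sum_apply]
    conv_lhs => rw [← e.sum_repr x]
    rw [map_sum]
    refine Finset.sum_congr rfl fun i _ => ?_
    rw [map_smul]
    rfl
  rw [h]
  exact map_sum (alternatizeUncurryFinCLM ℝ E V) _ _

lemma twoWedge_comm [FiniteDimensional ℝ E] (a b : E [⋀^Fin 2]→L[ℝ] ℝ) (w : E [⋀^Fin k]→L[ℝ] V) :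
    twoWedge a (twoWedge b w) = twoWedge b (twoWedge a w) := by
  simp only [twoWedge_eq_sum, map_sum, map_smul]
  rw [← Finset.smul_sum, ← Finset.smul_sum, Finset.sum_comm]
  simp only [oneWedge_four]

lemma twoWedge_add_left (a b : E [⋀^Fin 2]→L[ℝ] ℝ) (w : E [⋀^Fin k]→L[ℝ] V) :
    twoWedge (a + b) w = twoWedge a w + twoWedge b w := by
  ext v
  simp only [twoWedge_apply, ContinuousAlternatingMap.add_apply, add_smul, smul_add,
    Finset.sum_add_distrib]

variable (E) in
/-- Complex alternating forms of all degrees on a vector space. -/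
abbrev PointForm : Type _ := (k : ℕ) → E [⋀^Fin k]→L[ℝ] ℂ

/-- The operator `u ↦ a ∧ u` for a `2`-form `a`. -/
noncomputable def wedgePoint (a : E [⋀^Fin 2]→L[ℝ] ℝ) : PointForm E →ₗ[ℂ] PointForm E where
  toFun u k := match k with
    | 0 => 0
    | 1 => 0
    | k + 2 => twoWedge a (u k)
  map_add' u v := by
    funext k
    match k with
    | 0 => simp
    | 1 => simp
    | k + 2 => exact twoWedge_add _ _ _
  map_smul' c u := by
    funext k
    match k with
    | 0 => simp
    | 1 => simp
    | k + 2 => exact twoWedge_smul _ _ _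

lemma wedgePoint_add (a b : E [⋀^Fin 2]→L[ℝ] ℝ) :
    wedgePoint (a + b) = wedgePoint a + wedgePoint b := by
  ext1 u
  funext k
  match k with
  | 0 => exact (add_zero _).symm
  | 1 => exact (add_zero _).symm
  | k + 2 => exact twoWedge_add_left _ _ _

lemma wedgePoint_commute [FiniteDimensional ℝ E] (a b : E [⋀^Fin 2]→L[ℝ] ℝ) :
    Commute (wedgePoint a) (wedgePoint b) := by
  refine LinearMap.ext fun u => funext fun k => ?_
  match k with
  | 0 => rfl
  | 1 => rfl
  -- In degrees 2 and 3 the inner product is a component of degree 0 or 1, which is zero by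
  -- definition.
  | 2 => exact (twoWedge_zero a).trans (twoWedge_zero b).symm
  | 3 => exact (twoWedge_zero a).trans (twoWedge_zero b).symm
  | k + 4 => exact twoWedge_comm _ _ _

lemma wedgePoint_pow_eq_zero (a : E [⋀^Fin 2]→L[ℝ] ℝ) (u : PointForm E) (j k : ℕ) (h : k < 2 * j) :
    ((wedgePoint a ^ j) u) k = 0 := by
  induction j generalizing k with
  | zero => omega
  | succ j ih =>
    rw [pow_succ', Module.End.mul_apply]
    match k with
    | 0 => rfl
    | 1 => rfl
    | k + 2 =>
      change twoWedge a ((wedgePoint a ^ j) u k) = 0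
      rw [ih k (by omega), twoWedge_zero]

lemma alternating_eq_zero [FiniteDimensional ℝ E] (h : Module.finrank ℝ E < k)
    (w : E [⋀^Fin k]→L[ℝ] V) : w = 0 := by
  ext v
  refine w.toAlternatingMap.map_linearDependent v fun hv => ?_
  have := hv.fintype_card_le_finrank
  rw [Fintype.card_fin] at this
  omega

/-- A component of degree below `2 * j` is not reached by the power, and one of degree at least `2 *
j` lies above the dimension. Nilpotency makes the exponential of the operator available. -/
lemma wedgePoint_pow_eq_zero_of_finrank_lt [FiniteDimensional ℝ E] (a : E [⋀^Fin 2]→L[ℝ] ℝ) {j : ℕ}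
    (h : Module.finrank ℝ E < j) : wedgePoint a ^ j = 0 := by
  refine LinearMap.ext fun u => funext fun k => ?_
  by_cases hk : k < 2 * j
  · exact wedgePoint_pow_eq_zero a u j k hk
  · exact alternating_eq_zero (by omega) _

/-- The operator `u ↦ exp (a / 2π) ∧ u` for a `2`-form `a`. -/
noncomputable def expPoint (a : E [⋀^Fin 2]→L[ℝ] ℝ) : PointForm E →ₗ[ℂ] PointForm E where
  toFun u k := ∑ j ∈ Finset.range (k + 1),
    ((2 * Real.pi : ℂ) ^ j * (j.factorial : ℂ))⁻¹ • ((wedgePoint a ^ j) u) k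
  map_add' u v := by
    funext k
    simp [Finset.sum_add_distrib]
  map_smul' c u := by
    funext k
    simp only [map_smul, Pi.smul_apply, Finset.smul_sum, RingHom.id_apply]
    exact Finset.sum_congr rfl fun j _ => smul_comm _ _ _

lemma expPoint_eq_exp [FiniteDimensional ℝ E] (a : E [⋀^Fin 2]→L[ℝ] ℝ) :
    expPoint a = IsNilpotent.exp ((2 * Real.pi : ℂ)⁻¹ • wedgePoint a) := by
  refine LinearMap.ext fun u => funext fun k => ?_
  -- Large enough for the power to vanish and to include all terms of the sum in degree `k`; the
  -- additional terms are zero for reasons of degree.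
  set N := max (k + 1) (Module.finrank ℝ E + 1)
  have hN : ((2 * Real.pi : ℂ)⁻¹ • wedgePoint a) ^ N = 0 := by
    rw [smul_pow, wedgePoint_pow_eq_zero_of_finrank_lt a (by omega), smul_zero]
  rw [IsNilpotent.exp_eq_sum hN, LinearMap.sum_apply, Finset.sum_apply]
  change ∑ j ∈ Finset.range (k + 1), _ = _
  have hsub : Finset.range (k + 1) ⊆ Finset.range N := Finset.range_mono (le_max_left _ _)
  have hterm : ∀ j, ((j.factorial : ℚ)⁻¹ • ((2 * Real.pi : ℂ)⁻¹ • wedgePoint a) ^ j) u k =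
      ((2 * Real.pi : ℂ) ^ j * (j.factorial : ℂ))⁻¹ • ((wedgePoint a ^ j) u) k := by
    intro j
    rw [smul_pow, ← Rat.cast_smul_eq_qsmul ℂ, smul_smul]
    change (_ * _ : ℂ) • ((wedgePoint a ^ j) u k) = _
    congr 1
    rw [Rat.cast_inv, Rat.cast_natCast, inv_pow, mul_inv, mul_comm]
  rw [← Finset.sum_subset hsub fun j _ hj => ?_]
  · exact Finset.sum_congr rfl fun j _ => (hterm j).symm
  · rw [hterm, wedgePoint_pow_eq_zero, smul_zero]
    rw [Finset.mem_range] at hj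
    omega

/-- The exponential of a sum of commuting nilpotent operators is the product. With additive
curvature this is the identity `Ch(χχ') = Ch(χ) ∧ Ch(χ')` at a point. -/
lemma expPoint_add [FiniteDimensional ℝ E] (a b : E [⋀^Fin 2]→L[ℝ] ℝ) (u : PointForm E) :
    expPoint (a + b) u = expPoint a (expPoint b u) := by
  have hnil : ∀ a : E [⋀^Fin 2]→L[ℝ] ℝ, IsNilpotent ((2 * Real.pi : ℂ)⁻¹ • wedgePoint a) :=
    fun a => ⟨Module.finrank ℝ E + 1, by
      rw [smul_pow, wedgePoint_pow_eq_zero_of_finrank_lt a (by omega), smul_zero]⟩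
  rw [expPoint_eq_exp, expPoint_eq_exp a, expPoint_eq_exp b, wedgePoint_add, smul_add,
    IsNilpotent.exp_add_of_commute
      (((wedgePoint_commute a b).smul_left _).smul_right _) (hnil a) (hnil b)]
  rfl

variable {M : CornerManifold.{u}}

/-- The forms at a point, pulled back under a linear map into the tangent space. -/
noncomputable def evalPoint (x : M) (L : E →L[ℝ] M.E) : TotalForm M →ₗ[ℂ] PointForm E where
  toFun u k := (formAt (u k).1 x).compContinuousLinearMap L
  map_add' _ _ := rfl
  map_smul' _ _ := rfl

/-- The wedge product is pointwise and natural under linear maps. This carries the algebra to a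
single vector space, where forms on different hypersurfaces can be compared. -/
lemma evalPoint_expWedge (x : M) (L : E →L[ℝ] M.E) (a : TwoForm M) (u : TotalForm M) :
    evalPoint x L (expWedge a u) =
      expPoint ((formAt a.1 x).compContinuousLinearMap L) (evalPoint x L u) := by
  have h1 : ∀ u, evalPoint x L (wedgeTotal a u) =
      wedgePoint ((formAt a.1 x).compContinuousLinearMap L) (evalPoint x L u) := by
    intro u
    funext k
    match k with
    | 0 => rfl
    | 1 => rfl
    | k + 2 => exact twoWedge_comp (E := M.E) _ _ _
  have hp : ∀ j, evalPoint x L ((wedgeTotal a ^ j) u) =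
      (wedgePoint ((formAt a.1 x).compContinuousLinearMap L) ^ j) (evalPoint x L u) := by
    intro j
    induction j with
    | zero => rfl
    | succ j ih =>
      rw [pow_succ', pow_succ', Module.End.mul_apply, Module.End.mul_apply, h1, ih]
  funext k
  let ev : Form M k →ₗ[ℂ] E [⋀^Fin k]→L[ℝ] ℂ :=
    { toFun := fun η => (formAt η.1 x).compContinuousLinearMap L
      map_add' := fun _ _ => rfl
      map_smul' := fun _ _ => rfl }
  change ev (∑ j ∈ Finset.range (k + 1), _) = ∑ j ∈ Finset.range (k + 1), _
  rw [map_sum]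
  refine Finset.sum_congr rfl fun j _ => ?_
  rw [map_smul, ← hp]
  rfl

end PointwiseWedge

/-! ### Normal forms of formal sums modulo a group of characters -/

section Normalization

variable {Γ : Type*} [CommGroup Γ] (K : Subgroup Γ) {W W' : Type*} [AddCommGroup W] [Module ℂ W]
  [AddCommGroup W'] [Module ℂ W']

/-- A representative of the coset of an element. -/
noncomputable def cosetRep (g : Γ) : Γ := (g : Γ ⧸ K).out

lemma cosetRep_mul_inv_mem (g : Γ) : cosetRep K g * g⁻¹ ∈ K := by
  obtain ⟨h, hh⟩ := QuotientGroup.mk_out_eq_mul K g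
  rw [cosetRep, hh, mul_right_comm, mul_inv_cancel, one_mul]
  exact h.2

lemma cosetRep_mul (χ : K) (g : Γ) : cosetRep K (χ * g) = cosetRep K g := by
  have h : ((χ * g : Γ) : Γ ⧸ K) = (g : Γ ⧸ K) := by
    rw [mul_comm, QuotientGroup.mk_mul_of_mem g χ.2]
  rw [cosetRep, h, cosetRep]

/-- Formal sums `∑ uᵢ ⊗ gᵢ` in normal form modulo the relations `u ⊗ g ≃ e χ u ⊗ χ g`. -/
noncomputable def normalize (e : K → W →ₗ[ℂ] W) : (Γ →₀ W) →ₗ[ℂ] (Γ →₀ W) :=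
  Finsupp.lsum ℂ fun g =>
    Finsupp.lsingle (cosetRep K g) ∘ₗ e ⟨cosetRep K g * g⁻¹, cosetRep_mul_inv_mem K g⟩

lemma normalize_single (e : K → W →ₗ[ℂ] W) (g : Γ) (x : W) :
    normalize K e (Finsupp.single g x) = Finsupp.single (cosetRep K g)
      (e ⟨cosetRep K g * g⁻¹, cosetRep_mul_inv_mem K g⟩ x) := by
  simp [normalize]

/-- Both terms lie in the same coset and are moved to the same representative; multiplicativity of
`e` identifies moving there directly with passing through `χ * g`. So `normalize` kills the
relations. -/
lemma normalize_single_mul {e : K → W →ₗ[ℂ] W} (he : ∀ χ χ' x, e (χ * χ') x = e χ (e χ' x))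
    (χ : K) (g : Γ) (x : W) :
    normalize K e (Finsupp.single (χ * g) (e χ x)) = normalize K e (Finsupp.single g x) := by
  have h : (⟨cosetRep K (χ * g) * (χ * g)⁻¹, cosetRep_mul_inv_mem K (χ * g)⟩ * χ : K) =
      ⟨cosetRep K g * g⁻¹, cosetRep_mul_inv_mem K g⟩ := by
    refine Subtype.ext ?_
    change cosetRep K (χ * g) * (χ * g)⁻¹ * χ = cosetRep K g * g⁻¹
    rw [cosetRep_mul, mul_inv, mul_assoc, mul_right_comm, inv_mul_cancel, one_mul]
  rw [normalize_single, normalize_single, ← he, h, cosetRep_mul]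

/-- The chosen coset representatives depend on the group only and not on the coefficients, so
normalizing commutes with evaluation at a point. -/
lemma mapRange_normalize {e : K → W →ₗ[ℂ] W} {e' : K → W' →ₗ[ℂ] W'} (f : W →ₗ[ℂ] W')
    (h : ∀ χ x, f (e χ x) = e' χ (f x)) (x : Γ →₀ W) :
    Finsupp.mapRange.linearMap f (normalize K e x) =
      normalize K e' (Finsupp.mapRange.linearMap (α := Γ) f x) := by
  induction x using Finsupp.induction_linear with
  | zero => simp
  | add x y hx hy => rw [map_add, map_add, map_add, map_add, hx, hy]
  | single g x =>
    simp only [normalize_single, Finsupp.mapRange.linearMap_apply, Finsupp.mapRange_single, h]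

lemma normalize_apply_mem {e : K → W →ₗ[ℂ] W} {Q : Submodule ℂ W} (he : ∀ χ, ∀ x ∈ Q, e χ x ∈ Q)
    {x : Γ →₀ W} (hx : ∀ g, x g ∈ Q) (g : Γ) : normalize K e x g ∈ Q := by
  classical
  rw [normalize, Finsupp.lsum_apply, Finsupp.sum, Finsupp.finsetSum_apply]
  refine Submodule.sum_mem _ fun i _ => ?_
  change Finsupp.single _ _ g ∈ Q
  rw [Finsupp.single_apply]
  split_ifs
  exacts [he _ _ (hx i), Q.zero_mem]

end Normalization

/-! ### Normal forms of twisted forms -/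

section TwistedNormalization

variable {G : Type v} [CommGroup G] [TopologicalSpace G] {M N : CornerManifold.{u}}

lemma wedgeTotal_mem_parity {ε : ZMod 2} (a : TwoForm M) {u : TotalForm M}
    (hu : u ∈ parityForm M ε) : wedgeTotal a u ∈ parityForm M ε := by
  intro k hk
  match k with
  | 0 => rfl
  | 1 => rfl
  | k + 2 =>
    have h2 : ((k + 2 : ℕ) : ZMod 2) = k := by
      push_cast
      rw [show (2 : ZMod 2) = 0 from rfl, add_zero]
    have h0 := hu k (by rwa [h2] at hk)
    refine Subtype.ext (funext fun x => ?_)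
    change twoWedge (E := M.E) (a.1 x) ((u k).1 x) = 0
    rw [h0]
    exact twoWedge_zero (E := M.E) (a.1 x)

lemma expWedge_mem_parity {ε : ZMod 2} (a : TwoForm M) {u : TotalForm M}
    (hu : u ∈ parityForm M ε) : expWedge a u ∈ parityForm M ε := by
  have hp : ∀ j, (wedgeTotal a ^ j) u ∈ parityForm M ε := by
    intro j
    induction j with
    | zero => exact hu
    | succ j ih =>
      rw [pow_succ', Module.End.mul_apply]
      exact wedgeTotal_mem_parity a ih
  intro k hk
  change (∑ j ∈ Finset.range (k + 1), _ : Form M k) = 0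
  refine Finset.sum_eq_zero fun j _ => ?_
  rw [hp j k hk, smul_zero]

/-- Each term is moved to its coset representative by one of the defining relations, so the class is
unchanged. -/
lemma mkQ_normalize (T : Twist G M) (x : FormSum G M) :
    (twistRel T).mkQ (normalize T.chars (fun χ => expWedge (T.curv χ)) x) = (twistRel T).mkQ x := by
  induction x using Finsupp.induction_linear with
  | zero => rw [map_zero]
  | add x y hx hy => rw [map_add, map_add, map_add, hx, hy]
  | single g x =>
    have h : Finsupp.single g x - normalize T.chars (fun χ => expWedge (T.curv χ))
        (Finsupp.single g x) ∈ twistRel T := by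
      refine Submodule.subset_span
        ⟨⟨cosetRep T.chars g * g⁻¹, cosetRep_mul_inv_mem T.chars g⟩, g, x, ?_⟩
      rw [normalize_single, inv_mul_cancel_right]
    exact ((Submodule.Quotient.eq _).2 h).symm

/-- Formal sums of forms evaluated at a point, pulled back under a linear map. -/
noncomputable def sumEval {E : Type*} [NormedAddCommGroup E] [NormedSpace ℝ E] (x : M)
    (L : E →L[ℝ] M.E) : FormSum G M →ₗ[ℂ] (PontryaginDual G →₀ PointForm E) :=
  Finsupp.mapRange.linearMap (evalPoint x L)

variable {E : Type*} [NormedAddCommGroup E] [NormedSpace ℝ E]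

lemma sumEval_sumPull (f : SmoothMap M N) (x : M) (L : E →L[ℝ] M.E) (u : FormSum G N) :
    sumEval x L (sumPull G f u) = sumEval (f x) (tangent f x ∘L L) u :=
  Finsupp.ext fun _ => rfl

lemma sumEval_normalize (K : Subgroup (PontryaginDual G)) (x : M) (L : E →L[ℝ] M.E)
    (a : K → TwoForm M) (u : FormSum G M) :
    sumEval x L (normalize K (fun χ => expWedge (a χ)) u) =
      normalize K (fun χ => expPoint ((formAt (a χ).1 x).compContinuousLinearMap L))
        (sumEval x L u) :=
  mapRange_normalize K (evalPoint x L) (fun χ u => evalPoint_expWedge x L (a χ) u) u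

/-- The relations between twisted forms hold between normal forms for a larger group of
characters. -/
lemma normalize_sumEval_eq_zero [FiniteDimensional ℝ E] (K : Subgroup (PontryaginDual G))
    (b : K → E [⋀^Fin 2]→L[ℝ] ℝ) (hb : ∀ χ χ', b (χ * χ') = b χ + b χ') (T : Twist G M) (x : M)
    (L : E →L[ℝ] M.E)
    (hT : ∀ χ : T.chars, ∃ hχ : χ.1 ∈ K,
      b ⟨χ.1, hχ⟩ = (formAt (T.curv χ).1 x).compContinuousLinearMap L)
    {u : FormSum G M} (hu : u ∈ twistRel T) :
    normalize K (fun χ => expPoint (b χ)) (sumEval x L u) = 0 := by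
  -- It is enough to treat the spanning relations. As `b` is additive, `expPoint (b χ)` is
  -- multiplicative in `χ`, and `normalize_single_mul` applies.
  suffices h : twistRel T ≤
      LinearMap.ker (normalize K (fun χ => expPoint (b χ)) ∘ₗ sumEval (G := G) x L) from h hu
  refine Submodule.span_le.2 ?_
  rintro _ ⟨χ, g, u, rfl⟩
  obtain ⟨hχ, e⟩ := hT χ
  have hs : ∀ (g : PontryaginDual G) (u : TotalForm M),
      sumEval x L (Finsupp.single g u) = Finsupp.single g (evalPoint x L u) := fun g u =>
    Finsupp.mapRange_single (hf := map_zero (evalPoint x L))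
  rw [SetLike.mem_coe, LinearMap.mem_ker, LinearMap.comp_apply, map_sub, map_sub, hs, hs,
    evalPoint_expWedge, ← e, sub_eq_zero]
  exact (normalize_single_mul K (e := fun χ => expPoint (b χ))
    (fun χ χ' u => by simp only [hb, expPoint_add]) ⟨χ.1, hχ⟩ g _).symm

end TwistedNormalization

/-! ### Extension of compatible families of twisted forms -/

section Extension

variable {A : Type w} [PartialOrder A] {d : ℕ} {G : Type v} [CommGroup G] [TopologicalSpace G]
  [ChartedSpace (EuclideanSpace ℝ (Fin d)) G] {R : ResolvedAction.{u} A d G}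
  (C : IteratedConnection R)

/-- The connection forms on `X_α` are additive in the character, and pull-back along the submersion
`X_α → Y_α` is injective. -/
lemma IteratedConnection.curv_mul (α : A) (χ χ' : annihilator (R.isotropy α)) :
    (C.curv α (χ * χ')).1 = (C.curv α χ).1 + (C.curv α χ').1 := by
  refine pull_injective (R.isFibration α).surjective (R.isFibration α).surjective_mfderiv ?_
  have h : pull (R.proj α) ((C.curv α χ).1 + (C.curv α χ').1) =
    pull (R.proj α) (C.curv α χ).1 + pull (R.proj α) (C.curv α χ').1 := rfl
  rw [h, C.lift_curv, C.lift_curv, C.lift_curv, C.multiplicative,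
    extD_add (C.smooth α χ) (C.smooth α χ')]

/-- The normal form on `H_β(Y_α)` of the augmented pull-back of a formal sum. -/
noncomputable def IteratedConnection.faceForm {α β : A} (h : α < β)
    (f : FormSum G (R.Y.space β)) : FormSum G (R.Y.face α β h) :=
  normalize (C.twistFace h).chars (fun χ => expWedge ((C.twistFace h).curv χ))
    (sumPull G (R.Y.fib h) f)

lemma IteratedConnection.mkQ_faceForm {α β : A} (h : α < β) (f : FormSum G (R.Y.space β)) :
    (twistRel (C.twistFace h)).mkQ (C.faceForm h f) =
      C.augmentedPull h ((twistRel (C.twist β)).mkQ f) :=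
  mkQ_normalize (C.twistFace h) _

lemma IteratedConnection.faceForm_mem_parity {α β : A} (h : α < β) {ε : ZMod 2}
    {f : FormSum G (R.Y.space β)} (hf : ∀ g, f g ∈ parityForm _ ε) (g : PontryaginDual G) :
    C.faceForm h f g ∈ parityForm _ ε := by
  refine normalize_apply_mem _ (fun χ x hx => expWedge_mem_parity _ hx) (fun g k hk => ?_) g
  change pullForm (R.Y.fib h) k (f g k) = 0
  rw [hf g k hk, map_zero]

/-- Agreement of normal forms at a corner. Both are normal forms for the characters of `G / B_α`,
and at the corner they use the same curvature `b`. Before normalization, both are evaluations at `q`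
in `H_γ(Y_β)`, where the two formal sums differ by relations for the characters of `G / B_β`.
Normalizing for the larger group kills these. -/
lemma IteratedConnection.sumEval_faceForm {α β γ : A} (h : α < β) (h' : β < γ)
    (f : FormSum G (R.Y.space β)) (f' : FormSum G (R.Y.space γ))
    (hf : C.restrict h' ((twistRel (C.twist β)).mkQ f) =
      C.augmentedPull h' ((twistRel (C.twist γ)).mkQ f'))
    (p : R.Y.face α β h) (s : R.Y.face α γ (h.trans h')) (q : R.Y.face β γ h')
    (hps : R.Y.incl h p = R.Y.incl (h.trans h') s) (hqp : R.Y.incl h' q = R.Y.fib h p)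
    (hqs : R.Y.fib h' q = R.Y.fib (h.trans h') s)
    {E : Type*} [NormedAddCommGroup E] [NormedSpace ℝ E] [FiniteDimensional ℝ E]
    (Dl : E →L[ℝ] (R.Y.face α β h).E) (Df : E →L[ℝ] (R.Y.face α γ (h.trans h')).E)
    (Dm : E →L[ℝ] (R.Y.face β γ h').E)
    (h1 : tangent (R.Y.incl h) p ∘L Dl = tangent (R.Y.incl (h.trans h')) s ∘L Df)
    (h2 : tangent (R.Y.incl h') q ∘L Dm = tangent (R.Y.fib h) p ∘L Dl)
    (h3 : tangent (R.Y.fib h') q ∘L Dm = tangent (R.Y.fib (h.trans h')) s ∘L Df) :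
    sumEval p Dl (C.faceForm h f) = sumEval s Df (C.faceForm (h.trans h') f') := by
  let b : annihilator (R.isotropy α) → E [⋀^Fin 2]→L[ℝ] ℝ := fun χ =>
    (formAt (C.curv α χ).1 (R.Y.incl h p)).compContinuousLinearMap (tangent (R.Y.incl h) p ∘L Dl)
  have hb : ∀ χ χ', b (χ * χ') = b χ + b χ' := by
    intro χ χ'
    simp only [b, C.curv_mul]
    rfl
  have e1 : sumEval p Dl (C.faceForm h f) =
      normalize _ (fun χ => expPoint (b χ)) (sumEval p Dl (sumPull G (R.Y.fib h) f)) :=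
    sumEval_normalize _ p Dl _ _
  have e2 : sumEval s Df (C.faceForm (h.trans h') f') =
      normalize _ (fun χ => expPoint (b χ))
        (sumEval s Df (sumPull G (R.Y.fib (h.trans h')) f')) := by
    refine (sumEval_normalize _ s Df _ _).trans ?_
    congr 2
    funext χ
    simp only [b]
    rw [h1, hps]
    rfl
  have aux : ∀ {M : CornerManifold.{u}} {x x' : M} {L L' : E →L[ℝ] M.E} (u : FormSum G M),
      x = x' → L = L' → sumEval x L u = sumEval x' L' u := by
    rintro M x _ L _ u rfl rfl; rfl
  rw [e1, e2, sumEval_sumPull, sumEval_sumPull, aux f hqp.symm h2.symm, aux f' hqs.symm h3.symm,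
    ← sumEval_sumPull, ← sumEval_sumPull]
  -- It remains to see that on the characters of `G / B_β` the 2-form `b` is the curvature of `Y_β`
  -- at `q`: along `H_β(Y_α)` this curvature is the pull-back of the one on `Y_β`.
  suffices H : ∀ χ : (C.twistFace h').chars, ∃ hχ : χ.1 ∈ annihilator (R.isotropy α),
      b ⟨χ.1, hχ⟩ = (formAt ((C.twistFace h').curv χ).1 q).compContinuousLinearMap Dm by
    have key := normalize_sumEval_eq_zero _ b hb (C.twistFace h') q Dm H
      ((Submodule.Quotient.eq _).1 hf)
    rw [map_sub, map_sub] at key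
    exact sub_eq_zero.1 key
  intro χ
  obtain ⟨hχ, e⟩ := C.twistFace_curv h χ
  refine ⟨hχ, ?_⟩
  have e3 := congrArg (fun a : TwoForm (R.Y.face α β h) =>
    (formAt a.1 p).compContinuousLinearMap Dl) e
  refine e3.trans ?_
  change (formAt (C.curv β χ).1 (R.Y.fib h p)).compContinuousLinearMap
    (tangent (R.Y.fib h) p ∘L Dl) = (formAt (C.curv β χ).1 (R.Y.incl h' q)).compContinuousLinearMap
    (tangent (R.Y.incl h') q ∘L Dm)
  rw [h2, hqp]

/-- A compatible family of twisted forms over the indices above `α` is the boundary value of a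
twisted form on `Y_α`. -/
lemma IteratedConnection.exists_twistedForm [Finite A] (α : A) (ε : ZMod 2)
    (u : ∀ β, α < β → TwistedForm (C.twist β))
    (hu : ∀ β γ (h : α < β) (h' : β < γ),
      C.restrict h' (u β h) = C.augmentedPull h' (u γ (h.trans h')))
    (hε : ∀ β h, u β h ∈ twistParity (C.twist β) ε) :
    ∃ v ∈ twistParity (C.twist α) ε, ∀ β (h : α < β), C.restrict h v = C.augmentedPull h (u β h) := by
  classical
  choose f hfε hf using hε
  have hcorner : ∀ (β γ : A) (h : α < β) (h' : α < γ) (_ : β ≤ γ) (p : R.Y.face α β h)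
      (s : R.Y.face α γ h'), R.Y.incl h p = R.Y.incl h' s → ∀ (g : PontryaginDual G) (k : ℕ)
      (a : Fin k → (R.Y.face α β h).E) (b : Fin k → (R.Y.face α γ h').E),
      (∀ m, tangent (R.Y.incl h) p (a m) = tangent (R.Y.incl h') s (b m)) →
      formAt (C.faceForm h (f β h) g k).1 p a = formAt (C.faceForm h' (f γ h') g k).1 s b := by
    intro β γ h h' hβγ p s hps g k a b hab
    rcases hβγ.eq_or_lt with rfl | hβγ
    · obtain rfl := (R.Y.isBoundaryFace h).injective hps
      obtain rfl : a = b := funext fun m => R.Y.tangent_incl_injective h p (hab m)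
      rfl
    · obtain ⟨q, Dl, Df, Dm, hqp, hqs, h1, h2, h3, h4⟩ := R.Y.exists_corner_tangent h hβγ p s hps
      have e := C.sumEval_faceForm h hβγ (f β h) (f γ h') (by
        rw [hf, hf]
        exact hu β γ h hβγ) p s q hps hqp hqs Dl Df Dm h1 h2 h3
      have e' : formAt (C.faceForm h (f β h) g k).1 p (fun m => Dl (a m)) =
          formAt (C.faceForm h' (f γ h') g k).1 s (fun m => Df (a m)) :=
        congrArg (fun (x : PontryaginDual G →₀ PointForm (R.Y.face α β h).E) => x g k a) e
      simpa only [fun m => (h4 _ _ (hab m)).1, fun m => (h4 _ _ (hab m)).2] using e'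
  have hext : ∀ (g : PontryaginDual G) (k : ℕ), ∃ η : Form (R.Y.space α) k,
      (∀ β (h : α < β), pullForm (R.Y.incl h) k η = C.faceForm h (f β h) g k) ∧
      ((∀ β (h : α < β), C.faceForm h (f β h) g k = 0) → η = 0) := by
    intro g k
    -- Zero boundary values are extended by zero. This keeps the extension finitely supported in `g`
    -- and of the same parity.
    by_cases h0 : ∀ β (h : α < β), C.faceForm h (f β h) g k = 0
    · exact ⟨0, fun β h => by rw [map_zero, h0], fun _ => rfl⟩
    · obtain ⟨η, hη, hη'⟩ := R.Y.exists_extension (α := α) (k := k)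
        (fun β h => (C.faceForm h (f β h) g k).1) (fun β h => (C.faceForm h (f β h) g k).2) (by
          intro β γ h h' p s hps a b hab
          -- Hypersurfaces that meet have comparable indices, so every corner is covered by
          -- `hcorner`.
          rcases (R.Y.meet_iff h h').1 ⟨_, ⟨p, rfl⟩, ⟨s, hps.symm⟩⟩ with hβγ | hβγ
          · exact hcorner β γ h h' hβγ p s hps g k a b hab
          · exact (hcorner γ β h' h hβγ s p hps.symm g k b a fun m => (hab m).symm).symm)
      exact ⟨⟨η, hη⟩, fun β h => Subtype.ext (hη' β h), fun h => absurd h h0⟩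
  choose η hη hη0 using hext
  have hfin : {g | ∃ β, ∃ h : α < β, C.faceForm h (f β h) g ≠ 0}.Finite := by
    have : {g | ∃ β, ∃ h : α < β, C.faceForm h (f β h) g ≠ 0} =
        ⋃ β, ⋃ h : α < β, {g | C.faceForm h (f β h) g ≠ 0} := by
      ext g; simp
    rw [this]
    refine Set.finite_iUnion fun β => Set.finite_iUnion fun h => ?_
    exact (C.faceForm h (f β h)).hasFiniteSupport
  let x : FormSum G (R.Y.space α) := Finsupp.onFinset hfin.toFinset (fun g k => η g k) (by
    intro g hg
    rw [Set.Finite.mem_toFinset]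
    by_contra h0
    refine hg (funext fun k => hη0 g k fun β h => ?_)
    by_contra h1
    exact h0 ⟨β, h, fun h2 => h1 (congrFun h2 k)⟩)
  refine ⟨(twistRel (C.twist α)).mkQ x, ⟨x, fun g k hk => hη0 g k fun β h =>
    C.faceForm_mem_parity h (hfε β h) g k hk, rfl⟩, fun β h => ?_⟩
  -- For normal forms the boundary condition holds between formal sums, before passing to the
  -- quotient.
  have hx : sumPull G (R.Y.incl h) x = C.faceForm h (f β h) :=
    Finsupp.ext fun g => funext fun k => hη g k β h
  have e := C.mkQ_faceForm h (f β h)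
  rw [hf, ← hx] at e
  exact e

/-- Forms extend from one upper set of indices to the next. -/
lemma IteratedConnection.exists_extension_insert [Finite A] {S P : Set A} (hP : IsUpperSet P)
    {α : A} (hα : α ∉ S) (hS : IsUpperSet S) (hαS : ∀ β, α < β → β ∈ S) {ε : ZMod 2}
    {u : (β : S) → TwistedForm (C.twist β)} (hu : u ∈ C.forms S P ε) :
    ∃ v ∈ C.forms (insert α S) P ε, C.res (Set.subset_insert α S) v = u := by
  classical
  obtain ⟨x, hxε, hx⟩ := C.exists_twistedForm α ε (fun β h => u ⟨β, hαS β h⟩)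
    (fun β γ h h' => hu.1 ⟨β, hαS β h⟩ ⟨γ, hαS γ (h.trans h')⟩ h')
    (fun β h => hu.2.2 ⟨β, hαS β h⟩)
  obtain ⟨x', hxε', hx', hxP⟩ : ∃ x' ∈ twistParity (C.twist α) ε, (∀ β (h : α < β),
      C.restrict h x' = C.augmentedPull h (u ⟨β, hαS β h⟩)) ∧ (α ∈ P → x' = 0) := by
    -- Over an index in `P` the form has to be zero. This is compatible, since `P` contains
    -- everything above and the boundary values vanish.
    by_cases hαP : α ∈ P
    · refine ⟨0, zero_mem _, fun β h => ?_, fun _ => rfl⟩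
      rw [hu.2.1 ⟨β, hαS β h⟩ (hP h.le hαP), map_zero, map_zero]
    · exact ⟨x, hxε, hx, fun h => absurd h hαP⟩
  let v : (β : (insert α S : Set A)) → TwistedForm (C.twist β) := fun β =>
    if hβ : β.1 ∈ S then u ⟨β.1, hβ⟩ else
      (β.2.resolve_right hβ : β.1 = α).symm ▸ x'
  have hvS : ∀ β (hβ : β ∈ S), v ⟨β, Set.mem_insert_of_mem α hβ⟩ = u ⟨β, hβ⟩ := fun β hβ =>
    dif_pos hβ
  have hvα : v ⟨α, Set.mem_insert α S⟩ = x' := dif_neg hα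
  refine ⟨v, ⟨?_, ?_, ?_⟩, funext fun β => hvS β.1 β.2⟩
  · rintro ⟨β, hβ⟩ ⟨γ, hγ⟩ h
    change β < γ at h
    by_cases hβS : β ∈ S
    · have hγS : γ ∈ S := hS h.le hβS
      rw [hvS β hβS, hvS γ hγS]
      exact hu.1 ⟨β, hβS⟩ ⟨γ, hγS⟩ h
    · obtain rfl : β = α := hβ.resolve_right hβS
      rw [hvα, hvS γ (hαS γ h)]
      exact hx' γ h
  · rintro ⟨β, hβ⟩ hβP
    by_cases hβS : β ∈ S
    · rw [hvS β hβS]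
      exact hu.2.1 ⟨β, hβS⟩ hβP
    · obtain rfl : β = α := hβ.resolve_right hβS
      rw [hvα]
      exact hxP hβP
  · rintro ⟨β, hβ⟩
    by_cases hβS : β ∈ S
    · rw [hvS β hβS]
      exact hu.2.2 ⟨β, hβS⟩
    · obtain rfl : β = α := hβ.resolve_right hβS
      rw [hvα]
      exact hxε'

/-- The restriction of forms to an upper set of indices is surjective. -/
lemma IteratedConnection.exists_extension [Finite A] {P : Set A} (hP : IsUpperSet P) {ε : ZMod 2}
    (S : Set A) (hS : IsUpperSet S) {u : (β : S) → TwistedForm (C.twist β)}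
    (hu : u ∈ C.forms S P ε) :
    ∃ v ∈ C.forms Set.univ P ε, C.res (Set.subset_univ S) v = u := by
  by_cases hne : (Sᶜ).Nonempty
  -- For a maximal missing index all larger indices are present, so its boundary values are
  -- completely prescribed.
  · obtain ⟨α, hα⟩ := (Set.toFinite Sᶜ).exists_maximal hne
    have hαS : ∀ β, α < β → β ∈ S := fun β h => by
      by_contra hβ
      exact hα.not_gt hβ h
    have hS' : IsUpperSet (insert α S) := by
      rintro β γ h (rfl | hβ)
      · rcases h.eq_or_lt with rfl | h
        exacts [Set.mem_insert _ _, Set.mem_insert_of_mem _ (hαS γ h)]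
      · exact Set.mem_insert_of_mem _ (hS h hβ)
    obtain ⟨v, hv, hvu⟩ := C.exists_extension_insert hP hα.prop hS hαS hu
    obtain ⟨v', hv', hvv'⟩ := IteratedConnection.exists_extension hP (insert α S) hS' hv
    refine ⟨v', hv', ?_⟩
    rw [← hvu, ← hvv']
    rfl
  · obtain rfl : S = Set.univ := by
      rwa [Set.not_nonempty_iff_eq_empty, Set.compl_empty_iff] at hne
    exact ⟨u, hu, rfl⟩
termination_by (Sᶜ).ncard
decreasing_by
  refine Set.ncard_lt_ncard ?_ (Set.toFinite _)
  rw [Set.ssubset_iff_of_subset (Set.compl_subset_compl.2 (Set.subset_insert _ _))]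
  exact ⟨α, hα.prop, fun h => h (Set.mem_insert _ _)⟩

end Extension

/-! ### The connecting homomorphism -/

section LongExactSequence

variable {A : Type w} [PartialOrder A] {d : ℕ} {G : Type v} [CommGroup G] [TopologicalSpace G]
  [ChartedSpace (EuclideanSpace ℝ (Fin d)) G] {R : ResolvedAction.{u} A d G}
  (C : IteratedConnection R)

/-- Primitives of forms of parity `ε + 1` have parity `ε + 1 + 1`; this identity is what makes the
sequence periodic. -/
lemma add_one_add_one (ε : ZMod 2) : ε + 1 + 1 = ε := by
  rw [add_assoc, show (1 + 1 : ZMod 2) = 0 from rfl, add_zero]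

lemma IteratedConnection.mk_eq_mk_iff {S P : Set A} {ε : ZMod 2} {u u' : C.closedForms S P ε} :
    (Submodule.Quotient.mk u : C.Cohomology S P ε) = Submodule.Quotient.mk u' ↔
      ∃ w ∈ C.forms S P (ε + 1), C.diff S w = u.1 - u'.1 :=
  Submodule.Quotient.eq _

lemma IteratedConnection.mk_eq_zero_iff {S P : Set A} {ε : ZMod 2} {u : C.closedForms S P ε} :
    (Submodule.Quotient.mk u : C.Cohomology S P ε) = 0 ↔
      ∃ w ∈ C.forms S P (ε + 1), C.diff S w = u.1 :=
  Submodule.Quotient.mk_eq_zero _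

lemma IteratedConnection.forms_anti {S P P' : Set A} (h : P ⊆ P') (ε : ZMod 2) :
    C.forms S P' ε ≤ C.forms S P ε :=
  fun _ hu => ⟨hu.1, fun α hα => hu.2.1 α (h hα), hu.2.2⟩

lemma IteratedConnection.res_mem {S S' P : Set A} (h : S' ⊆ S) {ε : ZMod 2}
    {u : (α : S) → TwistedForm (C.twist α)} (hu : u ∈ C.forms S P ε) :
    C.res h u ∈ C.forms S' P ε :=
  ⟨fun α β hαβ => hu.1 ⟨α.1, h α.2⟩ ⟨β.1, h β.2⟩ hαβ,
    fun α hα => hu.2.1 ⟨α.1, h α.2⟩ hα, fun α => hu.2.2 ⟨α.1, h α.2⟩⟩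

lemma IteratedConnection.res_diff {S S' : Set A} (h : S' ⊆ S)
    (u : (α : S) → TwistedForm (C.twist α)) : C.res h (C.diff S u) = C.diff S' (C.res h u) := rfl

/-- The forms vanishing over one more index are those restricting to zero above that index. -/
lemma IteratedConnection.mem_forms_insert_iff {P : Set A} {α : A}
    (hα : ∀ β, α ≤ β → β ∈ insert α P) {ε : ZMod 2}
    {v : (β : (Set.univ : Set A)) → TwistedForm (C.twist β)} :
    v ∈ C.forms Set.univ (insert α P) ε ↔
      v ∈ C.forms Set.univ P ε ∧ C.res (Set.subset_univ (Set.Ici α)) v = 0 := by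
  refine ⟨fun h => ⟨C.forms_anti (Set.subset_insert α P) ε h,
    funext fun β => h.2.1 ⟨β.1, trivial⟩ (hα β.1 β.2)⟩, fun h => ⟨h.1.1, ?_, h.1.2.2⟩⟩
  rintro ⟨β, hβ⟩ (rfl | hβP)
  · exact congrFun h.2 ⟨β, le_refl β⟩
  · exact h.1.2.1 ⟨β, hβ⟩ hβP

/-- Lifts of forms can be chosen linearly, though not compatibly with the differential; the
connecting map is then linear by construction. -/
lemma exists_linear_section {W W' : Type*} [AddCommGroup W] [Module ℂ W] [AddCommGroup W']
    [Module ℂ W'] (f : W →ₗ[ℂ] W') (hf : Function.Surjective f) :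
    ∃ s : W' →ₗ[ℂ] W, ∀ x, f (s x) = x := by
  obtain ⟨s, hs⟩ := f.exists_rightInverse_of_surjective (LinearMap.range_eq_top.2 hf)
  exact ⟨s, LinearMap.congr_fun hs⟩

/-- The connecting homomorphism. -/
lemma IteratedConnection.exists_connecting [Finite A] {P : Set A} (hP : IsUpperSet P) {α : A}
    (hα : ∀ β, α ≤ β → β ∈ insert α P) (ε : ZMod 2) :
    ∃ δ : C.Cohomology (Set.Ici α) P ε →ₗ[ℂ] C.Cohomology Set.univ (insert α P) (ε + 1),
      ∀ (u : C.closedForms (Set.Ici α) P ε), ∀ v ∈ C.forms Set.univ P ε,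
        ∀ w : C.closedForms Set.univ (insert α P) (ε + 1),
          C.res (Set.subset_univ _) v = u.1 → w.1 = C.diff Set.univ v →
          δ (Submodule.Quotient.mk u) = Submodule.Quotient.mk w := by
  let r : C.forms Set.univ P ε →ₗ[ℂ] C.forms (Set.Ici α) P ε :=
    (C.res (Set.subset_univ (Set.Ici α))).restrict fun _ hu => C.res_mem _ hu
  have hr : Function.Surjective r := by
    rintro ⟨u, hu⟩
    obtain ⟨v, hv, hvu⟩ := C.exists_extension hP (Set.Ici α) (isUpperSet_Ici α) hu
    exact ⟨⟨v, hv⟩, Subtype.ext hvu⟩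
  obtain ⟨s, hs⟩ := exists_linear_section r hr
  have hs' : ∀ u : C.forms (Set.Ici α) P ε,
      C.res (Set.subset_univ (Set.Ici α)) (s u).1 = u.1 := fun u =>
    congrArg Subtype.val (hs u)
  -- The differential of the lift restricts to the differential of the closed form `u`, which is
  -- zero, so it belongs to the smaller complex.
  let δ₀ : C.closedForms (Set.Ici α) P ε →ₗ[ℂ] C.closedForms Set.univ (insert α P) (ε + 1) :=
    LinearMap.codRestrict _
      (C.diff Set.univ ∘ₗ (C.forms Set.univ P ε).subtype ∘ₗ s ∘ₗ
        Submodule.inclusion (inf_le_left : C.closedForms (Set.Ici α) P ε ≤ _))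
      fun u => ⟨(C.mem_forms_insert_iff hα).2 ⟨C.diff_mem (s _).2, by
        change C.res _ (C.diff Set.univ (s _).1) = 0
        rw [C.res_diff, hs']
        exact LinearMap.mem_ker.1 u.2.2⟩, C.diff_diff _ _⟩
  have hδ₀ : ∀ u, (δ₀ u).1 = C.diff Set.univ (s ⟨u.1, u.2.1⟩).1 := fun _ => rfl
  have hmem : ∀ v ∈ C.forms Set.univ P ε, C.res (Set.subset_univ (Set.Ici α)) v = 0 →
      v ∈ C.forms Set.univ (insert α P) (ε + 1 + 1) := by
    intro v hv h0
    rw [add_one_add_one]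
    exact (C.mem_forms_insert_iff hα).2 ⟨hv, h0⟩
  -- Two lifts of `u` differ by a form vanishing over `α`, which is a primitive of the difference of
  -- their differentials.
  refine ⟨Submodule.mapQ _ _ δ₀ ?_, fun u v hv w hvu hw => C.mk_eq_mk_iff.2
    ⟨(s ⟨u.1, u.2.1⟩).1 - v, hmem _ (sub_mem (s _).2 hv) ?_, ?_⟩⟩
  · rintro u ⟨y, hy, hyu⟩
    -- If `u = dy`, extend `y` to `z`. Subtracting `dz` from the lift of `u` gives a form vanishing
    -- over `α` with the same differential.
    obtain ⟨z, hz, hzy⟩ := C.exists_extension hP (Set.Ici α) (isUpperSet_Ici α) hy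
    have hdz := C.diff_mem hz
    rw [add_one_add_one] at hdz
    refine ⟨(s ⟨u.1, u.2.1⟩).1 - C.diff Set.univ z, hmem _ (sub_mem (s _).2 hdz) ?_, ?_⟩
    · rw [map_sub, hs', C.res_diff, hzy, hyu]
      exact sub_self u.1
    · rw [map_sub, C.diff_diff, sub_zero]
      rfl
  · rw [map_sub, hs', hvu, sub_self]
  · rw [map_sub, hδ₀, hw]

end LongExactSequence
end Deloc

/-! ### The six-term exact sequence -/

theorem proposition10p7p2018p2 {A : Type*} [Fintype A] [PartialOrder A] [OrderBot A]
    {d : ℕ} {G : Type*} [CommGroup G] [TopologicalSpace G]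
    [ChartedSpace (EuclideanSpace ℝ (Fin d)) G] [LieGroup (𝓡 d) ∞ G] [CompactSpace G] [T2Space G]
    (R : Deloc.ResolvedAction A d G) (C : Deloc.IteratedConnection R)
    (P : Set A) (α : A) (hP : IsLowerSet Pᶜ) (hα : α ∉ P) (hP' : IsLowerSet (insert α P)ᶜ) :
    ∃ δ : ∀ ε : ZMod 2, C.Cohomology (Set.Ici α) P ε →ₗ[ℂ]
        C.Cohomology Set.univ (insert α P) (ε + 1),
      (∀ (ε : ZMod 2) (u : C.closedForms (Set.Ici α) P ε),
        ∃ v ∈ C.forms Set.univ P ε, ∃ w : C.closedForms Set.univ (insert α P) (ε + 1),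
          C.res (Set.subset_univ _) v = u.1 ∧ w.1 = C.diff Set.univ v ∧
          δ ε (Submodule.Quotient.mk u) = Submodule.Quotient.mk w) ∧
      ∀ ε : ZMod 2,
        Function.Exact (C.forget (Set.subset_insert α P) Set.univ ε)
          (C.resCohomology (Set.subset_univ (Set.Ici α)) P ε) ∧
        Function.Exact (C.resCohomology (Set.subset_univ (Set.Ici α)) P ε) (δ ε) ∧
        Function.Exact (δ ε) (C.forget (Set.subset_insert α P) Set.univ (ε + 1)) := by
  have hPu : IsUpperSet P := isLowerSet_compl.1 hP
  -- An index above `α` outside `insert α P` would force `α` itself into the complement, which is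
  -- closed downwards.
  have hIci : ∀ β, α ≤ β → β ∈ insert α P := fun β h => by
    by_contra hβ
    exact hP' h hβ (Set.mem_insert α P)
  choose δ hδ using C.exists_connecting hPu hIci
  have hlift : ∀ (ε : ZMod 2) (u : C.closedForms (Set.Ici α) P ε),
      ∃ v ∈ C.forms Set.univ P ε, ∃ w : C.closedForms Set.univ (insert α P) (ε + 1),
        C.res (Set.subset_univ _) v = u.1 ∧ w.1 = C.diff Set.univ v := by
    intro ε u
    obtain ⟨v, hv, hvu⟩ := C.exists_extension hPu (Set.Ici α) (isUpperSet_Ici α) u.2.1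
    refine ⟨v, hv, ⟨C.diff Set.univ v, (C.mem_forms_insert_iff hIci).2
      ⟨C.diff_mem hv, ?_⟩, C.diff_diff _ _⟩, hvu, rfl⟩
    rw [C.res_diff, hvu]
    exact LinearMap.mem_ker.1 u.2.2
  refine ⟨δ, fun ε u => ?_, fun ε => ⟨fun y => ?_, fun y => ?_, fun y => ?_⟩⟩
  · obtain ⟨v, hv, w, hvu, hw⟩ := hlift ε u
    exact ⟨v, hv, w, hvu, hw, hδ ε u v hv w hvu hw⟩
  · constructor
    · obtain ⟨v, rfl⟩ := Submodule.Quotient.mk_surjective _ y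
      intro h
      obtain ⟨x, hx, hxv⟩ := C.mk_eq_zero_iff.1 h
      -- The restriction of `v` is `dx`; subtracting `dz`, for an extension `z` of `x`, makes it
      -- vanish without changing the class.
      obtain ⟨z, hz, hzx⟩ := C.exists_extension hPu (Set.Ici α) (isUpperSet_Ici α) hx
      have hdz := C.diff_mem hz
      rw [Deloc.add_one_add_one] at hdz
      refine ⟨Submodule.Quotient.mk ⟨v.1 - C.diff Set.univ z,
        (C.mem_forms_insert_iff hIci).2 ⟨sub_mem v.2.1 hdz, ?_⟩, ?_⟩,
        C.mk_eq_mk_iff.2 ⟨-z, neg_mem hz, ?_⟩⟩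
      · rw [map_sub, C.res_diff, hzx, hxv]
        exact sub_self _
      · rw [SetLike.mem_coe, LinearMap.mem_ker, map_sub, C.diff_diff, sub_zero]
        exact LinearMap.mem_ker.1 v.2.2
      · rw [map_neg]
        exact (sub_sub_cancel_left v.1 _).symm
    · rintro ⟨y, rfl⟩
      obtain ⟨v, rfl⟩ := Submodule.Quotient.mk_surjective _ y
      refine C.mk_eq_zero_iff.2 ⟨0, zero_mem _, ?_⟩
      rw [map_zero]
      exact ((C.mem_forms_insert_iff hIci).1 v.2.1).2.symm
  · obtain ⟨u, rfl⟩ := Submodule.Quotient.mk_surjective _ y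
    constructor
    · intro h
      obtain ⟨v, hv, w, hvu, hw⟩ := hlift ε u
      rw [hδ ε u v hv w hvu hw, C.mk_eq_zero_iff] at h
      obtain ⟨z, hz, hzw⟩ := h
      rw [Deloc.add_one_add_one, C.mem_forms_insert_iff hIci] at hz
      -- The lift `v` and the form `z` vanishing over `α` have the same differential, so `v - z` is
      -- a closed lift of `u`.
      refine ⟨Submodule.Quotient.mk ⟨v - z, sub_mem hv hz.1, ?_⟩,
        congrArg Submodule.Quotient.mk (Subtype.ext ?_)⟩
      · rw [SetLike.mem_coe, LinearMap.mem_ker, map_sub, hzw, hw, sub_self]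
      · change C.res (Set.subset_univ (Set.Ici α)) (v - z) = u.1
        rw [map_sub, hvu, hz.2, sub_zero]
    · rintro ⟨y, hy⟩
      obtain ⟨v, rfl⟩ := Submodule.Quotient.mk_surjective _ y
      rw [← hy]
      -- A restriction of a closed form has that form as a lift, with differential zero.
      exact hδ ε _ v.1 v.2.1 0 rfl (LinearMap.mem_ker.1 v.2.2).symm
  · constructor
    · obtain ⟨w, rfl⟩ := Submodule.Quotient.mk_surjective _ y
      intro h
      obtain ⟨z, hz, hzw⟩ := C.mk_eq_zero_iff.1 h
      rw [Deloc.add_one_add_one] at hz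
      -- A primitive `z` of `w` that need not vanish over `α` is a lift of its own restriction,
      -- which is closed because `w` vanishes there.
      refine ⟨Submodule.Quotient.mk ⟨C.res _ z, C.res_mem _ hz, ?_⟩,
        hδ ε _ z hz w rfl hzw.symm⟩
      rw [SetLike.mem_coe, LinearMap.mem_ker, ← C.res_diff, hzw]
      exact ((C.mem_forms_insert_iff hIci).1 w.2.1).2
    · rintro ⟨y, rfl⟩
      obtain ⟨u, rfl⟩ := Submodule.Quotient.mk_surjective _ y
      obtain ⟨v, hv, w, hvu, hw⟩ := hlift ε u
      rw [hδ ε u v hv w hvu hw]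
      -- In the larger complex the lift `v` itself is a primitive of `w`.
      refine C.mk_eq_zero_iff.2 ⟨v, ?_, hw.symm⟩
      rwa [Deloc.add_one_add_one]
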